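/- **Setting.** Let $Z=Z(t,y^1,y^2)\in\mathbb R^3$ be a smooth observer parametrization of (a patch of) a moving surface $\mathcal S$, defined on an open set of $(t,y)$, with $\partial_1Z,\partial_2Z$ linearly independent, and let $N$ be a smooth unit normal field. Put $X=(t,Z)\in\mathbb R^4$, $\eta_{IJ}=\langle\partial_IX,\partial_JX\rangle$ ($I,J\in\{t,1,2\}$), $g_{ij}=\langle\partial_iZ,\partial_jZ\rangle$ ($i,j\in\{1,2\}$), with Levi-Civita connection $\nabla$ of $g$, second fundamental form $I\!I_{ij}=\langle\partial_i\partial_jZ,N\rangle$, $\partial_tZ=v+\nu N$ with $v$ tangential, $\zeta=(1+\nu^2)^{-1}$, and transversal direction $\tau=[1,-v]$ in the frame $(\partial_tX,\partial_iX)$. Let $v_{\mathfrak m}$ be a smooth tangential field (the tangential material velocity), $u=v_{\mathfrak m}-v$, $\tau_{\mathfrak m}=[1,u]$, $\mathcal B=\nabla v-\nu I\!I$, $\mathcal B_{\mathfrak m}=\nabla v_{\mathfrak m}-\nu I\!I$, $\dot f=\partial_tf+\nabla_uf$ for scalars. For a tangential $m$-tensor field $q$ let $\dot q$ be the tangential total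 derivative, i.e. the orthogonal projection to $T^m\mathcal S$ of the componentwise total derivative $\partial_t+u^k\partial_k$ of the Euclidean components of $q$. Write $[Q\cdot_\beta q]^{i_1\ldots i_m}=Q^{i_\beta}{}_k\,q^{i_1\ldots k\ldots i_m}$. A shuffle $\sigma\in Sh(n,\alpha)$ is a permutation of $\{1,\ldots,n\}$ increasing on $\{1,\ldots,\alpha\}$ and on $\{\alpha+1,\ldots,n\}$; it is determined by its front set $\{\sigma(1),\ldots,\sigma(\alpha)\}$. The shuffle $\sigma^\beta$ ($\beta\le\alpha$) has $\sigma(\beta)$ removed from the front set, $\sigma_\beta$ ($\beta\le n-\alpha$) has $\sigma(\alpha+\beta)$ added to it, and $\bar\beta$ is determined by $(\sigma^\beta)_{\bar\beta}=\sigma$. A section of the observer-invariant bundle is a family $r=\sum_\alpha\sum_{\sigma\in Sh(n,\alpha)}r_\sigma e_\sigma$ of smooth tangential $(n-\alpha)$-tensor fields $r_\sigma$. It corresponds to the spacetime $n$-tensor field $R=[\![r]\!]^{-1}$, $$R^{I_1\ldots I_n}=\sum_{\alpha,\sigma}\tau^{I_{\sigma(1)}}\cdots\tau^{I_{\sigma(\alpha)}}\,\hat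 r_\sigma^{I_{\sigma(\alpha+1)}\ldots I_{\sigma(n)}},$$ where $\hat r_\sigma$ is $r_\sigma$ extended by zero to indices containing $t$; the inverse map $[\![\cdot]\!]$ applies the transversal projection in the slots $\sigma(1),\ldots,\sigma(\alpha)$ and the instantaneous projection in the others, contracts the transversal slots with $\zeta\tau$, and keeps the spatial components. For $\tilde\sigma\in Sh(n,\tilde\alpha)$ let $\flat_{\tilde\sigma}$ lower (with $\eta$) the slots $\tilde\sigma(\tilde\alpha+1),\ldots,\tilde\sigma(n)$, let $\sharp_{\tilde\sigma}$ be its inverse, and define $\mathsf L^{\tilde\sigma}=[\![\cdot]\!]\circ\sharp_{\tilde\sigma}\circ\mathcal L_{\tau_{\mathfrak m}}\circ\flat_{\tilde\sigma}\circ[\![\cdot]\!]^{-1}$ with components $\mathsf L^{\tilde\sigma}_\sigma$; $\mathsf L^{\sharp^n}$ and $\mathsf L^{\flat^n}$ are the cases of no, respectively all, indices lowered, and $\mathsf J$ is $[\![\cdot]\!]\circ J\circ[\![\cdot]\!]^{-1}$, where $J$ is the mean of the corresponding two derivatives of spacetime tensor fields. On tangential $m$-tensor fields, for $\check\sigma\in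 Sh(m,\check\alpha)$ and with lowering and raising by $g$, put $\mathfrak L^{\check\sigma}=\sharp_{\check\sigma}\circ(\partial_t+\mathcal L_u)\circ\flat_{\check\sigma}$ and $\partial_t^{\check\sigma}=\sharp_{\check\sigma}\circ\partial_t\circ\flat_{\check\sigma}$, with $\partial_t$ acting on the mixed component functions. **Theorem (Convected derivatives).** For all $n$, all $r$ as above, all $\tilde\sigma\in Sh(n,\tilde\alpha)$ and $\sigma\in Sh(n,\alpha)$, let $m=n-\alpha$ and let $\check\sigma\in Sh(m,\check\alpha)$ be obtained from $\tilde\sigma$ by deleting $\sigma(1),\ldots,\sigma(\alpha)$ and renumbering the remaining entries in increasing order; let $\mathcal E(\beta)$ be the condition $(\tilde\sigma^{-1}\circ\sigma)(\alpha+\beta)\le\tilde\alpha$. Then $$[\mathsf L^{\tilde\sigma}_\sigma r]^{i_1\ldots i_m}=[\mathfrak L^{\check\sigma}r_\sigma]^{i_1\ldots i_m}+\zeta\!\!\sum_{\beta\le\alpha,\ (\tilde\sigma^{-1}\circ\sigma)(\beta)>\tilde\alpha}\!\!\Big([\mathfrak L^\sharp v_{\mathfrak m}]_k\,r_{\sigma^\beta}^{i_1\ldots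 i_{\bar\beta-1}k\,i_{\bar\beta}\ldots i_m}+2\nu\dot\nu\,r_\sigma^{i_1\ldots i_m}\Big)-\sum_{\beta\le m,\ \mathcal E(\beta)}[\mathfrak L^\sharp v_{\mathfrak m}]^{i_\beta}\,r_{\sigma_\beta}^{i_1\ldots\widehat{i_\beta}\ldots i_m},$$ $$[\mathfrak L^\sharp v_{\mathfrak m}]^i=\partial_tv_{\mathfrak m}^i+[\nabla_uv_{\mathfrak m}-\nabla_{v_{\mathfrak m}}u]^i,$$ $$\mathfrak L^{\check\sigma}r_\sigma=\partial_t^{\check\sigma}r_\sigma+\nabla_ur_\sigma-\sum_{\mathcal E(\beta)}(\nabla u)\cdot_\beta r_\sigma+\sum_{\neg\mathcal E(\beta)}(\nabla u)^T\cdot_\beta r_\sigma=\dot r_\sigma-\sum_{\mathcal E(\beta)}\mathcal B_{\mathfrak m}\cdot_\beta r_\sigma+\sum_{\neg\mathcal E(\beta)}\mathcal B_{\mathfrak m}^T\cdot_\beta r_\sigma,$$ $$\partial_t^{\check\sigma}r_\sigma=\{\partial_tr_\sigma^{i_1\ldots i_m}\}+\sum_{\neg\mathcal E(\beta)}(\mathcal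 B+\mathcal B^T)\cdot_\beta r_\sigma,\qquad \mathcal E(\beta)\iff\check\sigma^{-1}(\beta)\le\check\alpha .$$ In particular $$[\mathsf L^{\sharp^n}_\sigma r]^{i_1\ldots i_m}=[\mathfrak L^{\sharp^m}r_\sigma]^{i_1\ldots i_m}-\sum_{\beta=1}^m[\mathfrak L^\sharp v_{\mathfrak m}]^{i_\beta}r_{\sigma_\beta}^{i_1\ldots\widehat{i_\beta}\ldots i_m},$$ $$[\mathsf L^{\flat^n}_\sigma r]^{i_1\ldots i_m}=[\mathfrak L^{\flat^m}r_\sigma+2\alpha\zeta\nu\dot\nu\,r_\sigma]^{i_1\ldots i_m}+\zeta[\mathfrak L^\sharp v_{\mathfrak m}]_k\sum_{\beta=1}^\alpha r_{\sigma^\beta}^{i_1\ldots i_{\bar\beta-1}k\,i_{\bar\beta}\ldots i_m},$$ $$\mathfrak L^{\sharp^m}r_\sigma=\{\partial_tr_\sigma^{i_1\ldots i_m}\}+\nabla_ur_\sigma-\sum_{\beta=1}^m(\nabla u)\cdot_\beta r_\sigma=\dot r_\sigma-\sum_{\beta=1}^m\mathcal B_{\mathfrak m}\cdot_\beta r_\sigma,$$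 $$\mathfrak L^{\flat^m}r_\sigma=\{g^{i_1j_1}\cdots g^{i_mj_m}\partial_t[r_\sigma]_{j_1\ldots j_m}\}+\nabla_ur_\sigma+\sum_{\beta=1}^m(\nabla u)^T\cdot_\beta r_\sigma=\dot r_\sigma+\sum_{\beta=1}^m\mathcal B_{\mathfrak m}^T\cdot_\beta r_\sigma,$$ where $\dot r_\sigma=\{\partial_tr_\sigma^{i_1\ldots i_m}\}+\nabla_ur_\sigma+\sum_{\beta=1}^m\mathcal B\cdot_\beta r_\sigma$. The Jaumann derivative satisfies $\mathsf J_\sigma r=\tfrac12(\mathsf L^{\sharp^n}_\sigma r+\mathsf L^{\flat^n}_\sigma r)$ and $$[\mathsf J_\sigma r]^{i_1\ldots i_m}=\Big[\dot r_\sigma+\alpha\zeta\nu\dot\nu\,r_\sigma-\frac{\operatorname{rot}v_{\mathfrak m}}2\sum_{\beta=1}^m*_\beta r_\sigma\Big]^{i_1\ldots i_m}+\frac\zeta2[\mathfrak L^\sharp v_{\mathfrak m}]_k\sum_{\beta=1}^\alpha r_{\sigma^\beta}^{i_1\ldots i_{\bar\beta-1}k\,i_{\bar\beta}\ldots i_m}-\frac12\sum_{\beta=1}^m[\mathfrak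 L^\sharp v_{\mathfrak m}]^{i_\beta}r_{\sigma_\beta}^{i_1\ldots\widehat{i_\beta}\ldots i_m},$$ with $\epsilon_{ij}=\sqrt{\det g}\,\varepsilon_{ij}$ ($\varepsilon_{ij}$ the Levi-Civita symbols), $\operatorname{rot}v_{\mathfrak m}=-\langle\nabla v_{\mathfrak m},\epsilon\rangle$ and $*_\beta r_\sigma=-\epsilon\cdot_\beta r_\sigma$. -/

import Mathlib

open scoped ContDiff

noncomputable section

/-! ### Shuffles -/

/-- The shuffles of `{1, …, n}` with `α` front and `m = n - α` rear entries, i.e. the words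
`(σ(1) … σ(α) ∣ σ(α+1) … σ(n))` whose front and rear parts are both increasing.  The positions
`1, …, α` of the front part are `Sum.inl β`, the positions `α+1, …, α+m` of the rear part are
`Sum.inr β`.  (The type is empty unless `α + m = n`.) -/
def Shuffle (n α m : ℕ) : Type :=
  {σ : Fin α ⊕ Fin m ≃ Fin n //
    StrictMono (fun β => σ (Sum.inl β)) ∧ StrictMono (fun β => σ (Sum.inr β))}

namespace Shuffle

variable {n α m : ℕ}

instance : Fintype (Shuffle n α m) := by
  classical
  exact Subtype.fintype _

/-- The `β`-th front entry `σ(β)`. -/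
def front (σ : Shuffle n α m) (β : Fin α) : Fin n := σ.1 (Sum.inl β)

/-- The `β`-th rear entry `σ(α+β)`. -/
def rear (σ : Shuffle n α m) (β : Fin m) : Fin n := σ.1 (Sum.inr β)

/-- The set of front entries. -/
def frontSet (σ : Shuffle n α m) : Finset (Fin n) := Finset.univ.image σ.front

/-- `σ.InFront l` says that `σ⁻¹(l) ≤ α`. -/
def InFront (σ : Shuffle n α m) (l : Fin n) : Prop := (σ.1.symm l).isLeft = true

instance (σ : Shuffle n α m) (l : Fin n) : Decidable (σ.InFront l) :=
  inferInstanceAs (Decidable (_ = true))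

theorem front_injective (σ : Shuffle n α m) : Function.Injective σ.front :=
  σ.2.1.injective

theorem card_frontSet (σ : Shuffle n α m) : σ.frontSet.card = α := by
  simp [frontSet, Finset.card_image_of_injective _ σ.front_injective]

theorem card_compl_frontSet (σ : Shuffle n α m) : σ.frontSetᶜ.card = m := by
  have h := Fintype.card_congr σ.1
  simp at h
  rw [Finset.card_compl, card_frontSet, Fintype.card_fin]
  omega

theorem rear_notMem_frontSet (σ : Shuffle n α m) (β : Fin m) : σ.rear β ∉ σ.frontSet := by
  simp [frontSet, front, rear]

theorem front_mem_frontSet (σ : Shuffle n α m) (β : Fin α) : σ.front β ∈ σ.frontSet := by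
  simp [frontSet]

/-- The unique shuffle with a given set of front entries. -/
def ofFinset (T : Finset (Fin n)) (hα : T.card = α) (hm : Tᶜ.card = m) : Shuffle n α m :=
  ⟨finSumEquivOfFinset hα hm, by
    constructor
    · intro a b h
      simpa using h
    · intro a b h
      simpa using h⟩

/-- `σ^β`: the `β`-th front entry of `σ` becomes a rear entry. -/
def toRear (σ : Shuffle n α m) (β : Fin α) : Shuffle n (α - 1) (m + 1) :=
  ofFinset (σ.frontSet.erase (σ.front β))
    (by rw [Finset.card_erase_of_mem (σ.front_mem_frontSet β), card_frontSet])
    (by rw [Finset.compl_erase, Finset.card_insert_of_notMem (by simp [frontSet]),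
          card_compl_frontSet])

/-- `σ_β`: the `β`-th rear entry of `σ` becomes a front entry. -/
def toFront (σ : Shuffle n α m) (β : Fin m) : Shuffle n (α + 1) (m - 1) :=
  ofFinset (insert (σ.rear β) σ.frontSet)
    (by rw [Finset.card_insert_of_notMem (σ.rear_notMem_frontSet β), card_frontSet])
    (by rw [Finset.compl_insert, Finset.card_erase_of_mem
          (by simpa using σ.rear_notMem_frontSet β), card_compl_frontSet])

/-- `β̄`: the place of `σ(β)` among the rear entries of `σ^β` (see `rear_bar`), so that turning
the `β̄`-th rear entry of `σ^β` into a front entry gives `σ` back. -/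
def bar (σ : Shuffle n α m) (β : Fin α) : Fin (m + 1) :=
  Sum.elim (fun _ => 0) id ((σ.toRear β).1.symm (σ.front β))

theorem rear_bar (σ : Shuffle n α m) (β : Fin α) :
    (σ.toRear β).rear (σ.bar β) = σ.front β := by
  unfold bar rear
  rcases h : (σ.toRear β).1.symm (σ.front β) with a | b
  · exfalso
    rw [Equiv.symm_apply_eq] at h
    have h2 : (σ.toRear β).1 (Sum.inl a) ∈ σ.frontSet.erase (σ.front β) := by
      simp [toRear, ofFinset, finSumEquivOfFinset_inl]
    rw [← h] at h2
    simp at h2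
  · rw [Equiv.symm_apply_eq] at h
    simpa using h.symm

/-- The entries (renumbered in increasing order by `{1, …, m}`) of the rear part of `σ` that are
front entries of `τ`. -/
def restFront {a b : ℕ} (τ : Shuffle n a b) (σ : Shuffle n α m) : Finset (Fin m) :=
  Finset.univ.filter (fun β => σ.rear β ∈ τ.frontSet)

/-- `τ ∖ σ|_{1,…,α}`: the front entries of `σ` are removed from the word `τ` and the remaining
entries are renumbered by `{1, …, m}`, keeping their order. -/
def remove {a b : ℕ} (τ : Shuffle n a b) (σ : Shuffle n α m) :
    Shuffle m (τ.restFront σ).card (τ.restFront σ)ᶜ.card :=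
  ofFinset (τ.restFront σ) rfl rfl

/-- The shuffle `(1 … n ∣ )`. -/
def allFront (n : ℕ) : Shuffle n n 0 :=
  ⟨Equiv.sumEmpty (Fin n) (Fin 0), fun _ _ h => h, fun x => x.elim0⟩

/-- The shuffle `( ∣ 1 … n)`. -/
def allRear (n : ℕ) : Shuffle n 0 n :=
  ⟨Equiv.emptySum (Fin 0) (Fin n), fun x => x.elim0, fun _ _ h => h⟩

/-- The family over the slots `1, …, n` that is `A` at front entries and `B` at rear entries. -/
def pick {M : Type*} (σ : Shuffle n α m) (A B : M) (l : Fin n) : M :=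
  Sum.elim (fun _ => A) (fun _ => B) (σ.1.symm l)

/-- The multi-index `I` of length `n` with `I_{σ(β)} = K_β` and `I_{σ(α+β)} = L_β`. -/
def join {M : Type*} (σ : Shuffle n α m) (K : Fin α → M) (L : Fin m → M) (l : Fin n) : M :=
  Sum.elim K L (σ.1.symm l)

end Shuffle

/-! ### Index calculus -/

/-- Coordinates `(t, y¹, y²)` of an event; index `0` is `t`, index `i.succ` is `yⁱ`. -/
abbrev Event := Fin 3 → ℝ

/-- The partial derivative `∂_I f`. -/
def pd {E : Type*} [NormedAddCommGroup E] [NormedSpace ℝ E] (I : Fin 3) (f : Event → E)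
    (p : Event) : E :=
  fderiv ℝ f p (Pi.single I 1)

/-- Contravariant component functions of spacetime `n`-tensor fields; all indices in `{t, 1, 2}`. -/
abbrev SpacetimeField (n : ℕ) := Event → (Fin n → Fin 3) → ℝ

/-- Contravariant component functions of (time-dependent) tangential `m`-tensor fields on the
moving surface; all indices in `{1, 2}`. -/
abbrev SurfaceField (m : ℕ) := Event → (Fin m → Fin 2) → ℝ

/-- Sections of the observer-invariant spacetime tensor bundle: a tangential surface tensor
field `r_σ` of rank `n - α` for each shuffle `σ` with `α` front entries, `0 ≤ α ≤ n`. -/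
abbrev BundleField (n : ℕ) := ∀ ⦃α m : ℕ⦄, Shuffle n α m → SurfaceField m

/-- Apply a matrix in each slot: `T ↦ (M_1)^{I_1}_{J_1} ⋯ (M_n)^{I_n}_{J_n} T^{J_1 … J_n}`. -/
def slotwise {n : ℕ} {ι : Type*} [Fintype ι] (M : Fin n → Matrix ι ι ℝ) (T : (Fin n → ι) → ℝ)
    (I : Fin n → ι) : ℝ :=
  ∑ J : Fin n → ι, (∏ l, M l (I l) (J l)) * T J

/-- The product `Q ·_l T` in the `l`-th slot, `Q^{I_l}_K T^{I_1 … K … I_n}`. -/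
def dotSlot {n : ℕ} {ι : Type*} [Fintype ι] (Q : Matrix ι ι ℝ) (l : Fin n)
    (T : (Fin n → ι) → ℝ) (I : Fin n → ι) : ℝ :=
  ∑ K, Q (I l) K * T (Function.update I l K)

/-- The Lie derivative along the vector field `w^K ∂_K` of a tensor field whose slots are
contravariant at the front entries of `τ` and covariant at its rear entries; `c` embeds the tensor
indices into the coordinate indices. -/
def lieDeriv {n a b : ℕ} {ι : Type*} [Fintype ι] [DecidableEq ι] (c : ι → Fin 3)
    (w : Event → ι → ℝ) (τ : Shuffle n a b) (T : Event → (Fin n → ι) → ℝ) :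
    Event → (Fin n → ι) → ℝ := fun p I =>
  (∑ K, w p K * pd (c K) (fun q => T q I) p)
    - (∑ β : Fin a, ∑ J, pd (c J) (fun q => w q (I (τ.front β))) p
        * T p (Function.update I (τ.front β) J))
    + ∑ β : Fin b, ∑ J, pd (c (I (τ.rear β))) (fun q => w q J) p
        * T p (Function.update I (τ.rear β) J)

/-- The multi-index `i_1 … i_{b-1} k i_b … i_m`. -/
def insertIdx {m : ℕ} (b : Fin (m + 1)) (k : Fin 2) (i : Fin m → Fin 2) : Fin (m + 1) → Fin 2 :=
  b.insertNth k i

/-- The multi-index `i_1 … i_{β-1} i_{β+1} … i_m`. -/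
def omitIdx {m : ℕ} (β : Fin m) (i : Fin m → Fin 2) : Fin (m - 1) → Fin 2 := fun j =>
  i ⟨if j.1 < β.1 then j.1 else j.1 + 1, by split_ifs <;> omega⟩

/-! ### Moving surfaces -/

/-- An observer parametrization (of a patch) of a smooth moving surface in `ℝ³`:
`(t, y¹, y²) ↦ Z`, an immersion for fixed `t`, with a choice `N` of the unit normal field. -/
structure MovingSurface where
  U : Set Event
  isOpen_U : IsOpen U
  Z : Event → EuclideanSpace ℝ (Fin 3)
  smooth_Z : ContDiffOn ℝ ∞ Z U
  immersion : ∀ p ∈ U, LinearIndependent ℝ (fun i : Fin 2 => pd i.succ Z p)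
  N : Event → EuclideanSpace ℝ (Fin 3)
  smooth_N : ContDiffOn ℝ ∞ N U
  norm_N : ∀ p ∈ U, ‖N p‖ = 1
  normal_N : ∀ p ∈ U, ∀ i : Fin 2, inner ℝ (N p) (pd i.succ Z p) = 0

namespace MovingSurface

variable (S : MovingSurface)

/-- The spatial metric `g_{ij} = ⟨∂_i Z, ∂_j Z⟩`. -/
def g (p : Event) : Matrix (Fin 2) (Fin 2) ℝ := fun i j =>
  inner ℝ (pd i.succ S.Z p) (pd j.succ S.Z p)

/-- The observer velocity `V = ∂_t Z`. -/
def V (p : Event) : EuclideanSpace ℝ (Fin 3) := pd 0 S.Z p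

/-- The tangential observer velocity `vⁱ`. -/
def v (p : Event) (i : Fin 2) : ℝ :=
  ∑ j, (S.g p)⁻¹ i j * inner ℝ (S.V p) (pd j.succ S.Z p)

/-- The normal velocity `ν`. -/
def nu (p : Event) : ℝ := inner ℝ (S.V p) (S.N p)

/-- `ζ = 1 / (1 + ν²)`. -/
def zeta (p : Event) : ℝ := 1 / (1 + S.nu p ^ 2)

/-- The spacetime parametrization `X = (t, Z)` into `ℝ⁴`. -/
def X (p : Event) : EuclideanSpace ℝ (Fin 4) :=
  WithLp.toLp 2 (Fin.cons (p 0) (fun a => S.Z p a))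

/-- The spacetime metric `η_{IJ} = ⟨∂_I X, ∂_J X⟩`. -/
def eta (p : Event) : Matrix (Fin 3) (Fin 3) ℝ := fun I J =>
  inner ℝ (pd I S.X p) (pd J S.X p)

/-- The transversal direction `τ = [1, -v]`, components `τ^I`. -/
def tau (p : Event) : Fin 3 → ℝ := Fin.cons 1 (fun i => - S.v p i)

/-- The covariant components `τ_I` of the transversal direction. -/
def tauLow (p : Event) (I : Fin 3) : ℝ := ∑ J, S.eta p I J * S.tau p J

/-- The transversal projection, as the endomorphism `[[1, 0], [-v, 0]]`. -/
def projTrans (p : Event) : Matrix (Fin 3) (Fin 3) ℝ := fun I J =>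
  if J = 0 then S.tau p I else 0

/-- The instantaneous projection, as the endomorphism `[[0, 0], [v, Id]]`. -/
def projInst (p : Event) : Matrix (Fin 3) (Fin 3) ℝ := 1 - S.projTrans p

/-- The component `[[R]]_σ` of the isomorphism from spacetime tensor fields to the observer-invariant
bundle: project with the shuffled projection, test the transversal slots with `ζ τ`, and keep the
spatial indices in the remaining slots. -/
def bracket {n : ℕ} (R : SpacetimeField n) : BundleField n := fun α _ σ p i =>
  ∑ K : Fin α → Fin 3, (∏ a, S.zeta p * S.tauLow p (K a))
    * slotwise (σ.pick (S.projTrans p) (S.projInst p)) (R p) (σ.join K (fun b => (i b).succ))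

/-- An instantaneous tensor from its spatial components: all components with a `t` vanish. -/
def extendZero {m : ℕ} (r : (Fin m → Fin 2) → ℝ) (I : Fin m → Fin 3) : ℝ :=
  if h : ∀ b, I b ≠ 0 then r (fun b => (I b).pred (h b)) else 0

/-- The inverse isomorphism,
`R^{I_1 … I_n} = ∑_σ τ^{I_{σ(1)}} ⋯ τ^{I_{σ(α)}} r_σ^{I_{σ(α+1)} … I_{σ(n)}}`. -/
def unbracket {n : ℕ} (r : BundleField n) : SpacetimeField n := fun p I =>
  ∑ x ∈ Finset.HasAntidiagonal.antidiagonal n, ∑ σ : Shuffle n x.1 x.2,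
    (∏ a, S.tau p (I (σ.front a))) * extendZero (r σ p) (fun b => I (σ.rear b))

/-- The relative velocity `u = v_𝔪 - v`, for the tangential material velocity `v_𝔪`. -/
def relVel (vm : Event → Fin 2 → ℝ) (p : Event) (i : Fin 2) : ℝ := vm p i - S.v p i

/-- The material direction `τ_𝔪 = [1, u]`. -/
def matDir (vm : Event → Fin 2 → ℝ) (p : Event) : Fin 3 → ℝ := Fin.cons 1 (S.relVel vm p)

/-! ### Convected derivatives -/

/-- The shuffled flat operator on spacetime tensors: the slots at rear entries of `τ` are lowered. -/
def flatST {n a b : ℕ} (τ : Shuffle n a b) (R : SpacetimeField n) : SpacetimeField n := fun p =>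
  slotwise (τ.pick 1 (S.eta p)) (R p)

/-- The shuffled sharp operator, inverse to `flatST`. -/
def sharpST {n a b : ℕ} (τ : Shuffle n a b) (R : SpacetimeField n) : SpacetimeField n := fun p =>
  slotwise (τ.pick 1 (S.eta p)⁻¹) (R p)

/-- The shuffled convected derivative of spacetime tensor fields, `♯_τ ∘ 𝓛_{τ_𝔪} ∘ ♭_τ`. -/
def convST (vm : Event → Fin 2 → ℝ) {n a b : ℕ} (τ : Shuffle n a b) (R : SpacetimeField n) :
    SpacetimeField n :=
  S.sharpST τ (lieDeriv id (S.matDir vm) τ (S.flatST τ R))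

/-- The Jaumann derivative of spacetime tensor fields. -/
def jaumannST (vm : Event → Fin 2 → ℝ) {n : ℕ} (R : SpacetimeField n) : SpacetimeField n :=
  fun p I => 1 / 2 *
    (S.convST vm (Shuffle.allFront n) R p I + S.convST vm (Shuffle.allRear n) R p I)

/-- The shuffled convected derivative on the observer-invariant bundle. -/
def conv (vm : Event → Fin 2 → ℝ) {n a b : ℕ} (τ : Shuffle n a b) (r : BundleField n) :
    BundleField n :=
  S.bracket (S.convST vm τ (S.unbracket r))

/-- The Jaumann derivative on the observer-invariant bundle. -/
def jaumann (vm : Event → Fin 2 → ℝ) {n : ℕ} (r : BundleField n) : BundleField n :=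
  S.bracket (S.jaumannST vm (S.unbracket r))

/-- The shuffled flat operator on surface tensors. -/
def flat {m a b : ℕ} (τ : Shuffle m a b) (r : SurfaceField m) : SurfaceField m := fun p =>
  slotwise (τ.pick 1 (S.g p)) (r p)

/-- The shuffled sharp operator on surface tensors, inverse to `flat`. -/
def sharp {m a b : ℕ} (τ : Shuffle m a b) (r : SurfaceField m) : SurfaceField m := fun p =>
  slotwise (τ.pick 1 (S.g p)⁻¹) (r p)

/-- The time derivative `{∂_t r^{♭_τ}}^{♯_τ}`; `∂_t` acts on the mixed proxy functions. -/
def dtShuffled {m a b : ℕ} (τ : Shuffle m a b) (r : SurfaceField m) : SurfaceField m :=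
  S.sharp τ (fun p i => pd 0 (fun q => S.flat τ r q i) p)

/-- The shuffled instantaneous convected derivative `♯_τ ∘ (∂_t + 𝓛_u) ∘ ♭_τ`. -/
def instConv (vm : Event → Fin 2 → ℝ) {m a b : ℕ} (τ : Shuffle m a b) (r : SurfaceField m) :
    SurfaceField m :=
  S.sharp τ (fun p i => pd 0 (fun q => S.flat τ r q i) p
    + lieDeriv Fin.succ (S.relVel vm) τ (S.flat τ r) p i)

/-- The instantaneous upper convected derivative of `v_𝔪`, contravariant components. -/
def convVm (vm : Event → Fin 2 → ℝ) (p : Event) (i : Fin 2) : ℝ :=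
  S.instConv vm (Shuffle.allFront 1) (fun q j => vm q (j 0)) p (fun _ => i)

/-- The covariant components of `convVm`. -/
def convVmLow (vm : Event → Fin 2 → ℝ) (p : Event) (k : Fin 2) : ℝ :=
  ∑ j, S.g p k j * S.convVm vm p j

/-! ### Surface quantities -/

/-- The Christoffel symbols `Γ^i_{kj} = g^{il} ⟨∂_k ∂_j Z, ∂_l Z⟩`. -/
def Gam (p : Event) (i k j : Fin 2) : ℝ :=
  ∑ l, (S.g p)⁻¹ i l * inner ℝ (pd k.succ (pd j.succ S.Z) p) (pd l.succ S.Z p)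

/-- The shape operator `II^i_j = g^{il} ⟨∂_l ∂_j Z, N⟩`. -/
def shape (p : Event) : Matrix (Fin 2) (Fin 2) ℝ := fun i j =>
  ∑ l, (S.g p)⁻¹ i l * inner ℝ (pd l.succ (pd j.succ S.Z) p) (S.N p)

/-- The covariant derivative of a vector field, `(∇w)^i_k = w^i_{|k}`. -/
def grad (w : Event → Fin 2 → ℝ) (p : Event) : Matrix (Fin 2) (Fin 2) ℝ := fun i k =>
  pd k.succ (fun q => w q i) p + ∑ j, S.Gam p i k j * w p j

/-- The directional covariant derivative `(∇_w r)^{i_1 … i_m} = w^k r^{i_1 … i_m}_{|k}`. -/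
def nablaDir (w : Event → Fin 2 → ℝ) {m : ℕ} (r : SurfaceField m) : SurfaceField m := fun p i =>
  ∑ k, w p k * (pd k.succ (fun q => r q i) p
    + ∑ β : Fin m, ∑ j, S.Gam p (i β) k j * r p (Function.update i β j))

/-- The metric transpose `(Qᵀ)^i_k = g^{ij} Q^l_j g_{lk}`. -/
def tr (p : Event) (Q : Matrix (Fin 2) (Fin 2) ℝ) : Matrix (Fin 2) (Fin 2) ℝ :=
  (S.g p)⁻¹ * Q.transpose * S.g p

/-- `𝓑 = ∇v - ν II`. -/
def B (p : Event) : Matrix (Fin 2) (Fin 2) ℝ := S.grad S.v p - S.nu p • S.shape p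

/-- `𝓑_𝔪 = ∇v_𝔪 - ν II`. -/
def Bm (vm : Event → Fin 2 → ℝ) (p : Event) : Matrix (Fin 2) (Fin 2) ℝ :=
  S.grad vm p - S.nu p • S.shape p

/-- The total derivative `∂_t f + ∇_u f` of scalar fields. -/
def dotScalar (vm : Event → Fin 2 → ℝ) (f : Event → ℝ) (p : Event) : ℝ :=
  pd 0 f p + ∑ k : Fin 2, S.relVel vm p k * pd k.succ f p

/-- The Euclidean components `r^{i_1 … i_m} ∂_{i_1} Z^{a_1} ⋯ ∂_{i_m} Z^{a_m}`. -/
def euclid {m : ℕ} (r : SurfaceField m) (p : Event) (a : Fin m → Fin 3) : ℝ :=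
  ∑ i : Fin m → Fin 2, r p i * ∏ b, pd (i b).succ S.Z p (a b)

/-- The tangential total derivative: the orthogonal projection to the surface of the
total derivative of the Euclidean components. -/
def dot (vm : Event → Fin 2 → ℝ) {m : ℕ} (r : SurfaceField m) : SurfaceField m := fun p j =>
  ∑ a : Fin m → Fin 3,
    (∏ b, ∑ l, (S.g p)⁻¹ (j b) l * pd l.succ S.Z p (a b))
      * S.dotScalar vm (fun q => S.euclid r q a) p

/-- The Levi-Civita tensor `ε_{ij} = √(det g) ε_{ij}`. -/
def eps (p : Event) : Matrix (Fin 2) (Fin 2) ℝ :=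
  Real.sqrt (S.g p).det • !![0, 1; -1, 0]

/-- The curl `rot w = -⟨∇w, ε⟩ = - w^i_{|j} g^{jk} ε_{ik}`. -/
def rot (w : Event → Fin 2 → ℝ) (p : Event) : ℝ :=
  - ∑ i, ∑ j, ∑ k, S.grad w p i j * (S.g p)⁻¹ j k * S.eps p i k

/-- The Hodge dual with respect to the `β`-th slot, `*_β r = -ε ·_β r`. -/
def hodge (p : Event) {m : ℕ} (β : Fin m) (r : (Fin m → Fin 2) → ℝ) (i : Fin m → Fin 2) : ℝ :=
  - dotSlot ((S.g p)⁻¹ * S.eps p) β r i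

end MovingSurface

end

/-! All the derivatives involved are one construction: a directional derivative plus one matrix per
slot, conjugated with a slotwise change of frame. If `M l * N l = 1` in every slot, conjugation
turns `∂_w + Σ E_l ·_l` into `∂_w + Σ (M_l ∂_w N_l + M_l E_l N_l) ·_l` (`contract_lie_contract`).
Every derivative thus becomes `∂_{τ_𝔪}` (for `dtShuffled`: `∂_t`) plus explicit matrices in the
slots, and the theorem reduces to matrix identities.

On spacetime the frame is `(τ, ∂_1 X, ∂_2 X)`. A frame multi-index is the same thing as a shuffle
(whose front set is the set of zeros) together with a spatial multi-index, so the family `r` simply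
lists the frame components of the tensor field (`bracket_eq`, `unbracket_eq`). In this frame `η` is
block diagonal with blocks `1 + ν²` and `g` (`eta_eq`). By `conv_frame`, an upper slot carries the
matrix `A` with columns `[τ_𝔪, e_J]`, and a lowered slot carries `H⁻¹ ∂H - H⁻¹ Aᵀ H`, where `H` is
the frame metric. The `t`-row of `A` vanishes and its `τ`-column is minus the upper convected
derivative of `v_𝔪`. This column couples `r_σ` to `r_{σ_β}` in upper slots; its transpose, weighted
with `ζ`, couples `r_σ` to `r_{σ^β}` in lowered slots. The term `2ζνν̇` comes from differentiating
`1 + ν²`. The spatial blocks are exactly the coefficients of the surface derivative (`conv_eq`).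

On the surface everything is expressed by `C_w = g⁻¹ Tᵀ ∂_w T`, where `T` is the matrix of tangent
vectors: `g⁻¹ ∂_w g = C_w + C_wᵀ` with the metric transpose, `C_{∂_t} = 𝓑` (`connection_zero`), and
`C_{∂_k}` consists of the Christoffel symbols. In the Jaumann mean only the antisymmetric part of
`𝓑_𝔪` survives. The shape operator is self-adjoint and drops out, and in dimension two what remains
is a multiple of `ε` (`Bm_sub_tr`). -/

noncomputable section

/-! ### Slotwise contraction -/

/-- Contract each slot of a tensor with a (possibly rectangular) matrix. -/
def contract {n : ℕ} {ι κ : Type*} [Fintype κ] (M : Fin n → Matrix ι κ ℝ)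
    (T : (Fin n → κ) → ℝ) (I : Fin n → ι) : ℝ :=
  ∑ J : Fin n → κ, (∏ l, M l (I l) (J l)) * T J

theorem slotwise_eq_contract {n : ℕ} {ι : Type*} [Fintype ι] (M : Fin n → Matrix ι ι ℝ)
    (T : (Fin n → ι) → ℝ) : slotwise M T = contract M T := rfl

/-- Expanding a product over the slots of sums over single indices gives the sum over multi-indices.
-/
theorem contract_contract {n : ℕ} {ι κ μ : Type*} [Fintype κ] [Fintype μ]
    (M : Fin n → Matrix ι κ ℝ) (N : Fin n → Matrix κ μ ℝ) (T : (Fin n → μ) → ℝ) :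
    contract M (contract N T) = contract (fun l => M l * N l) T := by
  classical
  funext I
  simp only [contract, Finset.mul_sum]
  rw [Finset.sum_comm]
  refine Finset.sum_congr rfl fun J _ => ?_
  simp only [Matrix.mul_apply]
  rw [Finset.prod_univ_sum, Fintype.piFinset_univ, Finset.sum_mul]
  refine Finset.sum_congr rfl fun K _ => ?_
  rw [Finset.prod_mul_distrib, mul_assoc]

theorem contract_add {n : ℕ} {ι κ : Type*} [Fintype κ] (M : Fin n → Matrix ι κ ℝ)
    (S T : (Fin n → κ) → ℝ) :
    contract M (fun J => S J + T J) = fun I => contract M S I + contract M T I := by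
  funext I
  simp only [contract, mul_add, Finset.sum_add_distrib]

theorem contract_sum {n : ℕ} {ι κ A : Type*} [Fintype κ] [Fintype A] (M : Fin n → Matrix ι κ ℝ)
    (T : A → (Fin n → κ) → ℝ) :
    contract M (fun J => ∑ a, T a J) = fun I => ∑ a, contract M (T a) I := by
  funext I
  simp only [contract, Finset.mul_sum]
  exact Finset.sum_comm

/-- Only multi-indices that agree with `I` off slot `l` survive the identity factors. Slot products
thereby fall under `contract_contract`. -/
theorem contract_update_one {n : ℕ} {ι : Type*} [Fintype ι] [DecidableEq ι]
    (Q : Matrix ι ι ℝ) (l : Fin n) (T : (Fin n → ι) → ℝ) :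
    contract (Function.update (fun _ => (1 : Matrix ι ι ℝ)) l Q) T = dotSlot Q l T := by
  funext I
  simp only [contract, dotSlot]
  symm
  refine Finset.sum_of_injOn (fun K => Function.update I l K) ?_ ?_ ?_ ?_
  · intro K _ K' _ h
    simpa using congrFun h l
  · intro K _
    simp
  · intro J _ hJ
    have : ∃ l', l' ≠ l ∧ I l' ≠ J l' := by
      by_contra! hc
      apply hJ
      refine ⟨J l, by simp, ?_⟩
      funext l'
      by_cases h : l' = l
      · subst h; simp
      · simp [h, hc l' h]
    obtain ⟨l', h1, h2⟩ := this
    rw [Finset.prod_eq_zero (Finset.mem_univ l'), zero_mul]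
    simp [h1, Matrix.one_apply_ne h2]
  · intro K _
    rw [Finset.prod_eq_single l]
    · simp
    · intro l' _ h
      simp [h]
    · simp

theorem contract_one {n : ℕ} {ι : Type*} [Fintype ι] [DecidableEq ι]
    (T : (Fin n → ι) → ℝ) : contract (fun _ => (1 : Matrix ι ι ℝ)) T = T := by
  funext I
  rw [contract, Finset.sum_eq_single I]
  · simp
  · intro J _ h
    obtain ⟨l, hl⟩ := Function.ne_iff.1 h
    rw [Finset.prod_eq_zero (Finset.mem_univ l), zero_mul]
    exact Matrix.one_apply_ne hl.symm
  · simp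

/-- Off slot `l` the factors collapse to the identity. Only a left inverse is required, and the
matrices may be rectangular. -/
theorem contract_dotSlot_contract {n : ℕ} {ι κ : Type*} [Fintype ι] [Fintype κ]
    [DecidableEq ι] [DecidableEq κ] (M : Fin n → Matrix ι κ ℝ) (N : Fin n → Matrix κ ι ℝ)
    (h : ∀ l, M l * N l = 1) (Q : Matrix κ κ ℝ) (l : Fin n) (T : (Fin n → ι) → ℝ) :
    contract M (dotSlot Q l (contract N T)) = dotSlot (M l * Q * N l) l T := by
  rw [← contract_update_one, contract_contract, contract_contract, ← contract_update_one]
  congr 1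
  funext k
  by_cases hk : k = l
  · subst hk; simp [Matrix.mul_assoc]
  · simp [hk, h]

theorem dotSlot_add {n : ℕ} {ι : Type*} [Fintype ι] (P Q : Matrix ι ι ℝ) (l : Fin n)
    (T : (Fin n → ι) → ℝ) (I : Fin n → ι) :
    dotSlot (P + Q) l T I = dotSlot P l T I + dotSlot Q l T I := by
  simp [dotSlot, add_mul, Finset.sum_add_distrib]

theorem dotSlot_neg {n : ℕ} {ι : Type*} [Fintype ι] (P : Matrix ι ι ℝ) (l : Fin n)
    (T : (Fin n → ι) → ℝ) (I : Fin n → ι) :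
    dotSlot (-P) l T I = -dotSlot P l T I := by
  simp [dotSlot]

theorem dotSlot_smul {n : ℕ} {ι : Type*} [Fintype ι] (c : ℝ) (P : Matrix ι ι ℝ) (l : Fin n)
    (T : (Fin n → ι) → ℝ) (I : Fin n → ι) :
    dotSlot (c • P) l T I = c * dotSlot P l T I := by
  simp [dotSlot, Finset.mul_sum, mul_assoc]

/-- The entrywise directional derivative of a matrix-valued function. -/
def matDeriv {ι κ : Type*} (N : Event → Matrix ι κ ℝ) (p w : Event) : Matrix ι κ ℝ :=
  Matrix.of fun i j => fderiv ℝ (fun q => N q i j) p w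

theorem matDeriv_apply {ι κ : Type*} (N : Event → Matrix ι κ ℝ) (p w : Event) (i : ι) (j : κ) :
    matDeriv N p w i j = fderiv ℝ (fun q => N q i j) p w := rfl

theorem fderiv_contract {n : ℕ} {ι κ : Type*} [Fintype κ]
    (N : Fin n → Event → Matrix ι κ ℝ) (r : Event → (Fin n → κ) → ℝ) (p w : Event)
    (hN : ∀ l i j, DifferentiableAt ℝ (fun q => N l q i j) p)
    (hr : ∀ J, DifferentiableAt ℝ (fun q => r q J) p) (I : Fin n → ι) :
    fderiv ℝ (fun q => contract (fun l => N l q) (r q) I) p w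
      = contract (fun l => N l p) (fun J => fderiv ℝ (fun q => r q J) p w) I
        + ∑ l, contract (Function.update (fun l => N l p) l (matDeriv (N l) p w)) (r p) I := by
  have h1 : ∀ J : Fin n → κ, HasFDerivAt (fun q => (∏ l, N l q (I l) (J l)) * r q J) _ p :=
    fun J => (HasFDerivAt.finsetProd (u := Finset.univ)
      (fun l _ => (hN l (I l) (J l)).hasFDerivAt)).mul (hr J).hasFDerivAt
  have h2 := HasFDerivAt.fun_sum (u := Finset.univ) (fun J _ => h1 J)
  simp only [contract]
  rw [h2.fderiv, Finset.sum_comm, ← Finset.sum_add_distrib]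
  simp only [sum_apply, add_apply, smul_apply, smul_eq_mul, Finset.mul_sum]
  refine Finset.sum_congr rfl fun J _ => ?_
  congr 1
  refine Finset.sum_congr rfl fun l _ => ?_
  rw [← Finset.mul_prod_erase Finset.univ _ (Finset.mem_univ l)]
  simp only [Function.update_self, matDeriv_apply]
  have : ∏ x ∈ Finset.univ.erase l,
      Function.update (fun l => N l p) l (matDeriv (N l) p w) x (I x) (J x)
      = ∏ x ∈ Finset.univ.erase l, N x p (I x) (J x) := by
    refine Finset.prod_congr rfl fun x hx => ?_
    rw [Function.update_of_ne (Finset.ne_of_mem_erase hx)]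
  rw [this]
  ring

/-- By the Leibniz rule the derivative hits the components or exactly one frame factor; all other
slots cancel. Rectangular frames are allowed so that `dot_eq` can use the embedding of the tangent
planes into `ℝ³`. -/
theorem contract_fderiv_contract {n : ℕ} {ι κ : Type*} [Fintype ι] [Fintype κ]
    [DecidableEq ι] (M : Fin n → Matrix ι κ ℝ) (N : Fin n → Event → Matrix κ ι ℝ)
    (r : Event → (Fin n → ι) → ℝ) (p w : Event)
    (hN : ∀ l i j, DifferentiableAt ℝ (fun q => N l q i j) p)
    (hr : ∀ J, DifferentiableAt ℝ (fun q => r q J) p)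
    (h : ∀ l, M l * N l p = 1) (I : Fin n → ι) :
    contract M (fun J => fderiv ℝ (fun q => contract (fun l => N l q) (r q) J) p w) I
      = fderiv ℝ (fun q => r q I) p w
        + ∑ l, dotSlot (M l * matDeriv (N l) p w) l (r p) I := by
  simp only [fderiv_contract N r p w hN hr]
  rw [contract_add, contract_sum]
  simp only [contract_contract, h]
  rw [contract_one]
  congr 1
  refine Finset.sum_congr rfl fun l _ => ?_
  rw [← contract_update_one]
  congr 2
  funext k
  by_cases hk : k = l
  · subst hk; simp
  · simp [hk, h]

/-! ### Shuffles -/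

namespace Shuffle

variable {n α m : ℕ}

theorem sum_eq {M : Type*} [AddCommMonoid M] (σ : Shuffle n α m) (f : Fin n → M) :
    ∑ l, f l = ∑ β, f (σ.front β) + ∑ β, f (σ.rear β) := by
  rw [← σ.1.sum_comp, Fintype.sum_sum_type]
  rfl

theorem prod_eq {M : Type*} [CommMonoid M] (σ : Shuffle n α m) (f : Fin n → M) :
    ∏ l, f l = (∏ β, f (σ.front β)) * ∏ β, f (σ.rear β) := by
  rw [← σ.1.prod_comp, Fintype.prod_sum_type]
  rfl

theorem inFront_front (σ : Shuffle n α m) (β : Fin α) : σ.InFront (σ.front β) := by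
  simp [InFront, front]

theorem not_inFront_rear (σ : Shuffle n α m) (β : Fin m) : ¬ σ.InFront (σ.rear β) := by
  simp [InFront, rear]

theorem mem_frontSet (σ : Shuffle n α m) (l : Fin n) : l ∈ σ.frontSet ↔ σ.InFront l := by
  obtain ⟨x, rfl⟩ := σ.1.surjective l
  rcases x with a | b
  · exact iff_of_true (σ.front_mem_frontSet a) (σ.inFront_front a)
  · exact iff_of_false (σ.rear_notMem_frontSet b) (σ.not_inFront_rear b)

theorem join_front {M : Type*} (σ : Shuffle n α m) (K : Fin α → M) (L : Fin m → M) (β : Fin α) :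
    σ.join K L (σ.front β) = K β := by
  simp [join, front]

theorem join_rear {M : Type*} (σ : Shuffle n α m) (K : Fin α → M) (L : Fin m → M) (β : Fin m) :
    σ.join K L (σ.rear β) = L β := by
  simp [join, rear]

theorem ext_cases (σ : Shuffle n α m) {P : Fin n → Prop} (h1 : ∀ β, P (σ.front β))
    (h2 : ∀ β, P (σ.rear β)) (l : Fin n) : P l := by
  obtain ⟨x, rfl⟩ := σ.1.surjective l
  rcases x with a | b
  · exact h1 a
  · exact h2 b

theorem pick_front {M : Type*} (σ : Shuffle n α m) (A B : M) (β : Fin α) :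
    σ.pick A B (σ.front β) = A := by
  simp [pick, front]

theorem pick_rear {M : Type*} (σ : Shuffle n α m) (A B : M) (β : Fin m) :
    σ.pick A B (σ.rear β) = B := by
  simp [pick, rear]

theorem pick_eq {M : Type*} (σ : Shuffle n α m) (A B : M) (l : Fin n) :
    σ.pick A B l = if σ.InFront l then A else B := by
  revert l
  refine σ.ext_cases (fun β => ?_) (fun β => ?_)
  · rw [pick_front, if_pos (σ.inFront_front β)]
  · rw [pick_rear, if_neg (σ.not_inFront_rear β)]

theorem frontSet_ofFinset (T : Finset (Fin n)) (hα : T.card = α) (hm : Tᶜ.card = m) :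
    (ofFinset T hα hm).frontSet = T := by
  have h : (ofFinset T hα hm).frontSet ⊆ T := by
    intro l hl
    simp only [frontSet, Finset.mem_image, Finset.mem_univ, true_and] at hl
    obtain ⟨a, rfl⟩ := hl
    simp [front, ofFinset, finSumEquivOfFinset_inl]
  exact Finset.eq_of_subset_of_card_le h (by rw [card_frontSet, hα])

theorem range_rear (σ : Shuffle n α m) : Set.range σ.rear = (σ.frontSet : Set (Fin n))ᶜ := by
  ext l
  constructor
  · rintro ⟨b, rfl⟩
    simpa using σ.rear_notMem_frontSet b
  · intro h
    obtain ⟨x, rfl⟩ := σ.1.surjective l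
    rcases x with a | b
    · exact absurd (σ.front_mem_frontSet a) h
    · exact ⟨b, rfl⟩

theorem rear_strictMono (σ : Shuffle n α m) : StrictMono σ.rear := σ.2.2

theorem front_strictMono (σ : Shuffle n α m) : StrictMono σ.front := σ.2.1

/-- An increasing enumeration is determined by its range, and the rear range is the complement of
the front one. -/
theorem eq_of_frontSet_eq {σ τ : Shuffle n α m} (h : σ.frontSet = τ.frontSet) : σ = τ := by
  have h1 : σ.front = τ.front := by
    refine (StrictMono.range_inj σ.front_strictMono τ.front_strictMono).1 ?_
    have := congrArg (fun s : Finset (Fin n) => (s : Set (Fin n))) h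
    simpa [frontSet] using this
  have h2 : σ.rear = τ.rear := by
    refine (StrictMono.range_inj σ.rear_strictMono τ.rear_strictMono).1 ?_
    rw [range_rear, range_rear, h]
  apply Subtype.ext
  apply Equiv.ext
  rintro (a | b)
  · exact congrFun h1 a
  · exact congrFun h2 b

/-- By cardinality, an increasing map that avoids the front entries must enumerate the whole rear.
This identifies the rear words of `σ^β` and `σ_β`. -/
theorem rear_eq_of_strictMono (σ : Shuffle n α m) {f : Fin m → Fin n} (hf : StrictMono f)
    (h : ∀ b, ¬ σ.InFront (f b)) : f = σ.rear := by
  refine (StrictMono.range_inj hf σ.rear_strictMono).1 ?_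
  refine Set.eq_of_subset_of_ncard_le ?_ ?_ (Set.toFinite _)
  · rintro _ ⟨b, rfl⟩
    rw [range_rear]
    simpa [mem_frontSet] using h b
  · rw [← Set.image_univ, ← Set.image_univ, Set.ncard_image_of_injective _ hf.injective,
      Set.ncard_image_of_injective _ σ.rear_strictMono.injective]

theorem frontSet_toRear (σ : Shuffle n α m) (β : Fin α) :
    (σ.toRear β).frontSet = σ.frontSet.erase (σ.front β) := frontSet_ofFinset _ _ _

theorem frontSet_toFront (σ : Shuffle n α m) (β : Fin m) :
    (σ.toFront β).frontSet = insert (σ.rear β) σ.frontSet := frontSet_ofFinset _ _ _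

theorem remove_inFront {a b : ℕ} (τ : Shuffle n a b) (σ : Shuffle n α m) (β : Fin m) :
    (τ.remove σ).InFront β ↔ τ.InFront (σ.rear β) := by
  rw [← mem_frontSet, remove, frontSet_ofFinset]
  simp [restFront, mem_frontSet]

theorem allFront_inFront (l : Fin n) : (allFront n).InFront l := rfl

theorem allRear_not_inFront (l : Fin n) : ¬ (allRear n).InFront l := by
  simp [InFront, allRear]

theorem rear_toRear_succAbove (σ : Shuffle n α m) (β : Fin α) (b : Fin m) :
    (σ.toRear β).rear ((σ.bar β).succAbove b) = σ.rear b := by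
  refine congrFun (σ.rear_eq_of_strictMono
    (f := fun b => (σ.toRear β).rear ((σ.bar β).succAbove b)) ?_ ?_) b
  · exact (σ.toRear β).rear_strictMono.comp (Fin.strictMono_succAbove _)
  · intro b hb
    have h := (σ.toRear β).rear_notMem_frontSet ((σ.bar β).succAbove b)
    rw [frontSet_toRear, Finset.mem_erase, mem_frontSet] at h
    refine h ⟨?_, hb⟩
    rw [← σ.rear_bar β]
    exact fun e => Fin.succAbove_ne _ _ ((σ.toRear β).rear_strictMono.injective e)

/-- The order embedding omitting `β`. -/
def skip {m : ℕ} (β : Fin m) (j : Fin (m - 1)) : Fin m :=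
  ⟨if j.1 < β.1 then j.1 else j.1 + 1, by split_ifs <;> omega⟩

theorem skip_strictMono {m : ℕ} (β : Fin m) : StrictMono (skip β) := by
  intro a b h
  rw [Fin.lt_def] at h ⊢
  simp only [skip]
  split_ifs <;> omega

theorem skip_ne {m : ℕ} (β : Fin m) (j : Fin (m - 1)) : skip β j ≠ β := by
  intro h
  have := congrArg Fin.val h
  simp only [skip] at this
  split_ifs at this <;> omega

theorem rear_toFront (σ : Shuffle n α m) (β : Fin m) (j : Fin (m - 1)) :
    (σ.toFront β).rear j = σ.rear (skip β j) := by
  refine (congrFun ((σ.toFront β).rear_eq_of_strictMono (f := fun j => σ.rear (skip β j)) ?_ ?_)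
    j).symm
  · exact σ.rear_strictMono.comp (skip_strictMono β)
  · intro j hj
    rw [← mem_frontSet, frontSet_toFront, Finset.mem_insert] at hj
    rcases hj with hj | hj
    · exact skip_ne β j (σ.rear_strictMono.injective hj)
    · exact σ.rear_notMem_frontSet _ hj

/-! ### Frame multi-indices as shuffles with spatial multi-indices -/

/-- The multi-index of a multi-index of spatial components in the rear slots, and `0` in front. -/
def frameIdx (σ : Shuffle n α m) (i : Fin m → Fin 2) : Fin n → Fin 3 :=
  σ.join (fun _ => 0) (fun b => (i b).succ)

theorem frameIdx_front (σ : Shuffle n α m) (i : Fin m → Fin 2) (β : Fin α) :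
    σ.frameIdx i (σ.front β) = 0 := σ.join_front _ _ β

theorem frameIdx_rear (σ : Shuffle n α m) (i : Fin m → Fin 2) (β : Fin m) :
    σ.frameIdx i (σ.rear β) = (i β).succ := σ.join_rear _ _ β

theorem eq_frameIdx (σ : Shuffle n α m) (i : Fin m → Fin 2) (J : Fin n → Fin 3)
    (h1 : ∀ β, J (σ.front β) = 0) (h2 : ∀ β, J (σ.rear β) = (i β).succ) : J = σ.frameIdx i := by
  funext l
  revert l
  exact σ.ext_cases (fun β => by rw [h1, frameIdx_front]) (fun β => by rw [h2, frameIdx_rear])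

theorem frontSet_eq_filter (σ : Shuffle n α m) (i : Fin m → Fin 2) :
    σ.frontSet = Finset.univ.filter (fun l => σ.frameIdx i l = 0) := by
  ext l
  revert l
  refine σ.ext_cases (fun β => ?_) (fun β => ?_)
  · simp [frameIdx_front, front_mem_frontSet]
  · simp [frameIdx_rear, rear_notMem_frontSet]

/-- The front set of the shuffle belonging to a frame multi-index. -/
def zeroSet (J : Fin n → Fin 3) : Finset (Fin n) := Finset.univ.filter (fun l => J l = 0)

/-- The shuffle belonging to a frame multi-index. -/
def ofIdx (J : Fin n → Fin 3) : Shuffle n (zeroSet J).card (zeroSet J)ᶜ.card :=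
  ofFinset (zeroSet J) rfl rfl

theorem frontSet_ofIdx (J : Fin n → Fin 3) : (ofIdx J).frontSet = zeroSet J :=
  frontSet_ofFinset _ _ _

theorem ofIdx_rear_ne (J : Fin n → Fin 3) (b : Fin (zeroSet J)ᶜ.card) :
    J ((ofIdx J).rear b) ≠ 0 := by
  have := (ofIdx J).rear_notMem_frontSet b
  rw [frontSet_ofIdx] at this
  simpa [zeroSet] using this

/-- The spatial multi-index belonging to a frame multi-index. -/
def spatial (J : Fin n → Fin 3) (b : Fin (zeroSet J)ᶜ.card) : Fin 2 :=
  (J ((ofIdx J).rear b)).pred (ofIdx_rear_ne J b)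

theorem frameIdx_spatial (J : Fin n → Fin 3) : (ofIdx J).frameIdx (spatial J) = J := by
  refine (eq_frameIdx _ _ _ (fun β => ?_) (fun β => ?_)).symm
  · have := (ofIdx J).front_mem_frontSet β
    rw [frontSet_ofIdx] at this
    simpa [zeroSet] using this
  · simp [spatial]

/-- The triples of a shuffle and a spatial multi-index for it are the frame multi-indices. -/
theorem sigma_eq_ofIdx (σ : Shuffle n α m) (i : Fin m → Fin 2) :
    (⟨(α, m), σ, i⟩ : Σ x : ℕ × ℕ, Σ _ : Shuffle n x.1 x.2, Fin x.2 → Fin 2)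
      = ⟨((zeroSet (σ.frameIdx i)).card, (zeroSet (σ.frameIdx i))ᶜ.card),
          ofIdx (σ.frameIdx i), spatial (σ.frameIdx i)⟩ := by
  -- `J` has to be opaque: `σ.frameIdx i` mentions `α` and `m`, which would block their substitution
  -- by the cardinalities below.
  obtain ⟨J, hJ⟩ : ∃ J, J = σ.frameIdx i := ⟨_, rfl⟩
  rw [← hJ]
  have hT : σ.frontSet = zeroSet J := by rw [hJ]; exact σ.frontSet_eq_filter i
  have hα : α = (zeroSet J).card := by rw [← hT, card_frontSet]
  have hm : m = (zeroSet J)ᶜ.card := by rw [← hT, card_compl_frontSet]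
  subst hα hm
  have hσ : σ = ofIdx J := eq_of_frontSet_eq (by rw [hT, frontSet_ofIdx])
  subst hσ
  have hi : i = spatial J := by
    funext b
    apply Fin.succ_injective
    rw [← (ofIdx J).frameIdx_rear i b, ← hJ]
    simp [spatial]
  rw [hi]

/-- The double sum over shuffles and spatial indices in `unbracket` is an ordinary sum over frame
multi-indices, hence a single slotwise contraction. -/
theorem sum_frameIdx (f : (Fin n → Fin 3) → ℝ) :
    ∑ x ∈ Finset.HasAntidiagonal.antidiagonal n, ∑ σ : Shuffle n x.1 x.2,
      ∑ i : Fin x.2 → Fin 2, f (σ.frameIdx i) = ∑ J, f J := by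
  have h : ∀ x : ℕ × ℕ, ∑ σ : Shuffle n x.1 x.2, ∑ i : Fin x.2 → Fin 2, f (σ.frameIdx i)
      = ∑ y : (Σ _ : Shuffle n x.1 x.2, Fin x.2 → Fin 2), f (y.1.frameIdx y.2) :=
    fun x => (Fintype.sum_sigma
      (fun y : (Σ _ : Shuffle n x.1 x.2, Fin x.2 → Fin 2) => f (y.1.frameIdx y.2))).symm
  simp only [h]
  rw [Finset.sum_sigma']
  refine Finset.sum_bij' (fun y _ => y.2.1.frameIdx y.2.2)
    (fun J _ => ⟨((zeroSet J).card, (zeroSet J)ᶜ.card), ofIdx J, spatial J⟩)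
    ?_ ?_ ?_ ?_ ?_
  · simp
  · intro J _
    simp [Finset.card_add_card_compl]
  · intro y _
    exact (sigma_eq_ofIdx y.2.1 y.2.2).symm
  · intro J _
    exact frameIdx_spatial J
  · simp

end Shuffle

/-! ### Frame components of bundle sections -/

namespace BundleField

variable {n α m : ℕ}

/-- The frame components of a section of the observer-invariant bundle. -/
def frame (r : BundleField n) : SpacetimeField n := fun p J =>
  r (Shuffle.ofIdx J) p (Shuffle.spatial J)

/-- The two shuffles have different types, so the comparison passes through the equality of
dependent triples in `Shuffle.sigma_eq_ofIdx`. -/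
theorem frame_frameIdx (r : BundleField n) (σ : Shuffle n α m) (p : Event) (i : Fin m → Fin 2) :
    frame r p (σ.frameIdx i) = r σ p i := by
  have h := congrArg (fun y : (Σ x : ℕ × ℕ, Σ _ : Shuffle n x.1 x.2, Fin x.2 → Fin 2) =>
    r y.2.1 p y.2.2) (σ.sigma_eq_ofIdx i)
  exact h.symm

theorem frame_update_rear (r : BundleField n) (σ : Shuffle n α m) (p : Event) (i : Fin m → Fin 2)
    (β : Fin m) (k : Fin 2) :
    frame r p (Function.update (σ.frameIdx i) (σ.rear β) k.succ)
      = r σ p (Function.update i β k) := by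
  rw [← frame_frameIdx r]
  congr 1
  refine σ.eq_frameIdx _ _ (fun b => ?_) (fun b => ?_)
  · rw [Function.update_of_ne, σ.frameIdx_front]
    exact fun e => σ.not_inFront_rear β (e ▸ σ.inFront_front b)
  · by_cases h : b = β
    · subst h; simp
    · rw [Function.update_of_ne, Function.update_of_ne h, σ.frameIdx_rear]
      exact fun e => h (σ.rear_strictMono.injective e)

/-- Setting a spatial entry to `0` makes its slot transversal; this is how `σ_β` enters the
formulas. -/
theorem frame_update_rear_zero (r : BundleField n) (σ : Shuffle n α m) (p : Event)
    (i : Fin m → Fin 2) (β : Fin m) :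
    frame r p (Function.update (σ.frameIdx i) (σ.rear β) 0)
      = r (σ.toFront β) p (omitIdx β i) := by
  rw [← frame_frameIdx r]
  congr 1
  refine (σ.toFront β).eq_frameIdx _ _ (fun b => ?_) (fun b => ?_)
  · have h := (σ.toFront β).front_mem_frontSet b
    rw [σ.frontSet_toFront, Finset.mem_insert] at h
    rcases h with h | h
    · rw [h]; simp
    · rw [Function.update_of_ne (fun e => σ.rear_notMem_frontSet β (by rwa [e] at h))]
      rw [σ.frontSet_eq_filter i] at h
      simpa using h
  · rw [σ.rear_toFront, Function.update_of_ne, σ.frameIdx_rear]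
    -- `Shuffle.skip` and `omitIdx` make the same case distinction.
    · rfl
    · exact fun e => Shuffle.skip_ne β b (σ.rear_strictMono.injective e)

/-- A transversal slot becomes spatial, and its new index sits at place `β̄` among the rear entries;
this is how `σ^β` enters. -/
theorem frame_update_front (r : BundleField n) (σ : Shuffle n α m) (p : Event)
    (i : Fin m → Fin 2) (β : Fin α) (k : Fin 2) :
    frame r p (Function.update (σ.frameIdx i) (σ.front β) k.succ)
      = r (σ.toRear β) p (insertIdx (σ.bar β) k i) := by
  rw [← frame_frameIdx r]
  congr 1
  refine (σ.toRear β).eq_frameIdx _ _ (fun b => ?_) (fun b => ?_)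
  · have h := (σ.toRear β).front_mem_frontSet b
    rw [σ.frontSet_toRear, Finset.mem_erase] at h
    rw [Function.update_of_ne h.1]
    have h2 := h.2
    rw [σ.frontSet_eq_filter i] at h2
    simpa using h2
  · rcases Fin.eq_self_or_eq_succAbove (σ.bar β) b with rfl | ⟨c, rfl⟩
    · rw [σ.rear_bar]
      simp [insertIdx]
    · rw [σ.rear_toRear_succAbove, Function.update_of_ne, σ.frameIdx_rear]
      · simp [insertIdx]
      · exact fun e => σ.not_inFront_rear c (e ▸ σ.inFront_front β)

end BundleField

/-! ### Lie derivatives in slotwise form -/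

/-- The matrix `∂_J w^I` of partial derivatives of a vector field. -/
def jac {ι : Type*} (c : ι → Fin 3) (w : Event → ι → ℝ) (p : Event) : Matrix ι ι ℝ :=
  Matrix.of fun i j => pd (c j) (fun q => w q i) p

theorem jac_apply {ι : Type*} (c : ι → Fin 3) (w : Event → ι → ℝ) (p : Event) (i j : ι) :
    jac c w p i j = pd (c j) (fun q => w q i) p := rfl

/-- The sums over front and rear entries merge into one sum over slots, the form required by
`contract_lie_contract`. -/
theorem lieDeriv_eq {n a b : ℕ} {ι : Type*} [Fintype ι] [DecidableEq ι] (c : ι → Fin 3)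
    (w : Event → ι → ℝ) (τ : Shuffle n a b) (T : Event → (Fin n → ι) → ℝ) (p : Event)
    (I : Fin n → ι) :
    lieDeriv c w τ T p I = fderiv ℝ (fun q => T q I) p (∑ K, w p K • Pi.single (c K) 1)
      + ∑ l, dotSlot (if τ.InFront l then -jac c w p else (jac c w p).transpose) l (T p) I := by
  rw [τ.sum_eq]
  have h1 : ∀ β, (if τ.InFront (τ.front β) then -jac c w p else (jac c w p).transpose)
      = -jac c w p := fun β => if_pos (τ.inFront_front β)
  have h2 : ∀ β, (if τ.InFront (τ.rear β) then -jac c w p else (jac c w p).transpose)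
      = (jac c w p).transpose := fun β => if_neg (τ.not_inFront_rear β)
  simp only [h1, h2, dotSlot_neg]
  simp only [lieDeriv, map_sum, map_smul, smul_eq_mul, dotSlot, Matrix.transpose_apply, jac_apply,
    Finset.sum_neg_distrib, pd]
  ring

/-- A Lie derivative (plus a transport term) conjugated with a change of frame. -/
theorem contract_lie_contract {n : ℕ} {ι κ : Type*} [Fintype ι] [Fintype κ]
    [DecidableEq ι] [DecidableEq κ] (M : Fin n → Matrix ι κ ℝ) (N : Fin n → Event → Matrix κ ι ℝ)
    (E : Fin n → Matrix κ κ ℝ) (r : Event → (Fin n → ι) → ℝ) (p w : Event)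
    (hN : ∀ l i j, DifferentiableAt ℝ (fun q => N l q i j) p)
    (hr : ∀ J, DifferentiableAt ℝ (fun q => r q J) p)
    (h : ∀ l, M l * N l p = 1) (I : Fin n → ι) :
    contract M (fun J => fderiv ℝ (fun q => contract (fun l => N l q) (r q) J) p w
        + ∑ l, dotSlot (E l) l (contract (fun l => N l p) (r p)) J) I
      = fderiv ℝ (fun q => r q I) p w
        + ∑ l, dotSlot (M l * matDeriv (N l) p w + M l * E l * N l p) l (r p) I := by
  rw [contract_add, contract_sum]
  simp only
  rw [contract_fderiv_contract M N r p w hN hr h, add_assoc, ← Finset.sum_add_distrib]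
  congr 1
  refine Finset.sum_congr rfl fun l _ => ?_
  rw [dotSlot_add, contract_dotSlot_contract M (fun l => N l p) h]

/-! ### Partial derivatives -/

theorem ContDiffOn.differentiableAt_of_isOpen {E : Type*} [NormedAddCommGroup E] [NormedSpace ℝ E]
    {f : Event → E} {U : Set Event} (hf : ContDiffOn ℝ ∞ f U) (hU : IsOpen U) {p : Event}
    (hp : p ∈ U) : DifferentiableAt ℝ f p :=
  (hf.contDiffAt (hU.mem_nhds hp)).differentiableAt (by simp)

theorem ContDiffOn.pd {E : Type*} [NormedAddCommGroup E] [NormedSpace ℝ E]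
    {f : Event → E} {U : Set Event} (hf : ContDiffOn ℝ ∞ f U) (hU : IsOpen U) (I : Fin 3) :
    ContDiffOn ℝ ∞ (pd I f) U :=
  (hf.fderiv_of_isOpen hU (by simp)).clm_apply contDiffOn_const

theorem pd_comm {E : Type*} [NormedAddCommGroup E] [NormedSpace ℝ E]
    {f : Event → E} {U : Set Event} (hf : ContDiffOn ℝ ∞ f U) (hU : IsOpen U) {p : Event}
    (hp : p ∈ U) (I J : Fin 3) : pd I (pd J f) p = pd J (pd I f) p := by
  have h := hf.contDiffAt (hU.mem_nhds hp)
  have hd : DifferentiableAt ℝ (fderiv ℝ f) p :=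
    (hf.fderiv_of_isOpen hU (m := ∞) (by simp)).differentiableAt_of_isOpen hU hp
  have hs : IsSymmSndFDerivAt ℝ f p := h.isSymmSndFDerivAt (by
    rw [minSmoothness_of_isRCLikeNormedField]
    exact WithTop.coe_le_coe.2 le_top)
  have key : ∀ K L : Fin 3, _root_.pd K (_root_.pd L f) p
      = fderiv ℝ (fderiv ℝ f) p (Pi.single K 1) (Pi.single L 1) := by
    intro K L
    have h1 := (hd.hasFDerivAt.clm_apply (hasFDerivAt_const (Pi.single L 1 : Event) p)).fderiv
    unfold _root_.pd
    rw [h1]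
    simp
  rw [key, key]
  exact hs _ _

theorem fderiv_euclidean_apply {n : ℕ} {f : Event → EuclideanSpace ℝ (Fin n)} {p : Event}
    (hf : DifferentiableAt ℝ f p) (w : Event) (a : Fin n) :
    fderiv ℝ (fun q => f q a) p w = fderiv ℝ f p w a := by
  have h := ((EuclideanSpace.proj (𝕜 := ℝ) a).hasFDerivAt.comp p hf.hasFDerivAt).fderiv
  exact congrArg (fun L => L w) h

theorem fderiv_sum_mul {A : Type*} [Fintype A] {f h : A → Event → ℝ} {p : Event}
    (hf : ∀ k, DifferentiableAt ℝ (f k) p) (hh : ∀ k, DifferentiableAt ℝ (h k) p) (w : Event) :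
    fderiv ℝ (fun q => ∑ k, f k q * h k q) p w
      = ∑ k, (f k p * fderiv ℝ (h k) p w + h k p * fderiv ℝ (f k) p w) := by
  have h1 := HasFDerivAt.fun_sum (u := Finset.univ)
    (fun k _ => (hf k).hasFDerivAt.fun_mul (hh k).hasFDerivAt)
  rw [h1.fderiv]
  simp only [sum_apply, add_apply, smul_apply, smul_eq_mul]

theorem pd_inner {n : ℕ} {f g : Event → EuclideanSpace ℝ (Fin n)} {p : Event}
    (hf : DifferentiableAt ℝ f p) (hg : DifferentiableAt ℝ g p) (I : Fin 3) :
    pd I (fun q => inner ℝ (f q) (g q)) p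
      = inner ℝ (f p) (pd I g p) + inner ℝ (pd I f p) (g p) :=
  fderiv_inner_apply ℝ hf hg _

theorem fderiv_eq_pd {f : Event → ℝ} (p w : Event) :
    fderiv ℝ f p w = ∑ K, w K * pd K f p := by
  conv_lhs => rw [pi_eq_sum_univ' w]
  simp only [map_sum, map_smul, smul_eq_mul, pd]

namespace MovingSurface

variable (S : MovingSurface)

/-! ### The metric -/

theorem g_symm (p : Event) (i j : Fin 2) : S.g p i j = S.g p j i :=
  real_inner_comm _ _

theorem g_transpose (p : Event) : (S.g p).transpose = S.g p := by
  ext i j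
  exact S.g_symm p j i

theorem det_g_pos {p : Event} (hp : p ∈ S.U) : 0 < (S.g p).det := by
  have h := (Matrix.posDef_gram_of_linearIndependent (𝕜 := ℝ) (S.immersion p hp)).det_pos
  exact h

theorem inv_g_mul {p : Event} (hp : p ∈ S.U) : (S.g p)⁻¹ * S.g p = 1 :=
  Matrix.nonsing_inv_mul _ (S.det_g_pos hp).ne'.isUnit

theorem g_mul_inv {p : Event} (hp : p ∈ S.U) : S.g p * (S.g p)⁻¹ = 1 :=
  Matrix.mul_nonsing_inv _ (S.det_g_pos hp).ne'.isUnit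

theorem inv_g_transpose (p : Event) : ((S.g p)⁻¹).transpose = (S.g p)⁻¹ := by
  rw [Matrix.transpose_nonsing_inv, g_transpose]

theorem contDiffOn_g (i j : Fin 2) : ContDiffOn ℝ ∞ (fun q => S.g q i j) S.U :=
  (S.smooth_Z.pd S.isOpen_U _).inner ℝ (S.smooth_Z.pd S.isOpen_U _)

theorem contDiffOn_inv_g (i j : Fin 2) : ContDiffOn ℝ ∞ (fun q => (S.g q)⁻¹ i j) S.U := by
  have hdet : ContDiffOn ℝ ∞ (fun q => (S.g q).det) S.U := by
    simp only [Matrix.det_fin_two]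
    exact ((S.contDiffOn_g 0 0).mul (S.contDiffOn_g 1 1)).sub
      ((S.contDiffOn_g 0 1).mul (S.contDiffOn_g 1 0))
  have hadj : ContDiffOn ℝ ∞ (fun q => (S.g q).adjugate i j) S.U := by
    simp only [Matrix.adjugate_fin_two]
    fin_cases i <;> fin_cases j
    · exact S.contDiffOn_g 1 1
    · exact (S.contDiffOn_g 0 1).neg
    · exact (S.contDiffOn_g 1 0).neg
    · exact S.contDiffOn_g 0 0
  have : (fun q => (S.g q)⁻¹ i j) = fun q => ((S.g q).det)⁻¹ * (S.g q).adjugate i j := by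
    funext q
    simp [Matrix.inv_def]
  rw [this]
  exact (hdet.inv fun q hq => (S.det_g_pos hq).ne').mul hadj

theorem contDiffOn_v (i : Fin 2) : ContDiffOn ℝ ∞ (fun q => S.v q i) S.U :=
  ContDiffOn.sum fun j _ => (S.contDiffOn_inv_g i j).mul
    ((S.smooth_Z.pd S.isOpen_U 0).inner ℝ (S.smooth_Z.pd S.isOpen_U _))

theorem contDiffOn_nu : ContDiffOn ℝ ∞ S.nu S.U :=
  (S.smooth_Z.pd S.isOpen_U 0).inner ℝ S.smooth_N

theorem inner_V {p : Event} (hp : p ∈ S.U) (j : Fin 2) :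
    inner ℝ (S.V p) (pd j.succ S.Z p) = ∑ k, S.g p j k * S.v p k := by
  have h : ∀ l, S.v p l = ((S.g p)⁻¹.mulVec fun j => inner ℝ (S.V p) (pd j.succ S.Z p)) l :=
    fun l => rfl
  have h2 : ∑ k, S.g p j k * S.v p k = ((S.g p).mulVec (S.v p)) j := rfl
  rw [h2, funext h, Matrix.mulVec_mulVec, S.g_mul_inv hp, Matrix.one_mulVec]

/-- The orthogonal complement of the tangent plane in `ℝ³` is a line, spanned by `N`. The difference
of the two sides lies on it and is orthogonal to `N`. -/
theorem V_eq {p : Event} (hp : p ∈ S.U) :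
    S.V p = (∑ k, S.v p k • pd k.succ S.Z p) + S.nu p • S.N p := by
  set K : Submodule ℝ (EuclideanSpace ℝ (Fin 3)) :=
    Submodule.span ℝ (Set.range fun i : Fin 2 => pd i.succ S.Z p) with hK
  have hfK : Module.finrank ℝ K = 2 := by
    simpa using finrank_span_eq_card (S.immersion p hp)
  have hfO : Module.finrank ℝ Kᗮ = 1 := by
    have := K.finrank_add_finrank_orthogonal
    simp only [finrank_euclideanSpace, Fintype.card_fin] at this
    omega
  have mem : ∀ x, (∀ i : Fin 2, inner ℝ x (pd i.succ S.Z p) = 0) → x ∈ Kᗮ := by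
    intro x hx
    rw [Submodule.mem_orthogonal']
    intro u hu
    induction hu using Submodule.span_induction with
    | mem y hy => obtain ⟨i, rfl⟩ := hy; exact hx i
    | zero => simp
    | add y z _ _ h1 h2 => rw [inner_add_right, h1, h2, add_zero]
    | smul c y _ h => rw [inner_smul_right, h, mul_zero]
  have hN := mem _ (S.normal_N p hp)
  have hW : S.V p - ((∑ k, S.v p k • pd k.succ S.Z p) + S.nu p • S.N p) ∈ Kᗮ := by
    apply mem
    intro i
    rw [inner_sub_left, inner_add_left, inner_smul_left, S.normal_N p hp, sum_inner,
      S.inner_V hp]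
    simp only [inner_smul_left, mul_zero, add_zero, sub_eq_zero]
    refine Finset.sum_congr rfl fun k _ => ?_
    rw [S.g_symm, mul_comm]
    rfl
  have hN0 : (⟨S.N p, hN⟩ : Kᗮ) ≠ 0 := by
    intro h
    have h1 := S.norm_N p hp
    rw [show S.N p = 0 from congrArg Subtype.val h, norm_zero] at h1
    exact zero_ne_one h1
  obtain ⟨c, hc⟩ := (finrank_eq_one_iff_of_nonzero' _ hN0).1 hfO ⟨_, hW⟩
  have hc' : c • S.N p = S.V p - ((∑ k, S.v p k • pd k.succ S.Z p) + S.nu p • S.N p) :=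
    congrArg Subtype.val hc
  have hNN : inner ℝ (S.N p) (S.N p) = 1 := by
    rw [real_inner_self_eq_norm_sq, S.norm_N p hp]; norm_num
  have h0 := congrArg (fun x => inner ℝ x (S.N p)) hc'
  have hZN : ∀ i : Fin 2, inner ℝ (pd i.succ S.Z p) (S.N p) = 0 := fun i => by
    rw [real_inner_comm]; exact S.normal_N p hp i
  simp only [inner_sub_left, inner_add_left, inner_smul_left, sum_inner, hZN, hNN] at h0
  have hc0 : c = 0 := by
    rw [show inner ℝ (S.V p) (S.N p) = S.nu p from rfl] at h0
    simpa using h0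
  rw [hc0, zero_smul] at hc'
  exact sub_eq_zero.1 hc'.symm

/-! ### The connection -/

/-- The matrix `∂_j Z^a`. -/
def tangentMat (p : Event) : Matrix (Fin 3) (Fin 2) ℝ := Matrix.of fun a j => pd j.succ S.Z p a

theorem tangentMat_apply (p : Event) (a : Fin 3) (j : Fin 2) :
    S.tangentMat p a j = pd j.succ S.Z p a := rfl

theorem differentiableAt_pd_Z {p : Event} (hp : p ∈ S.U) (I : Fin 3) :
    DifferentiableAt ℝ (pd I S.Z) p :=
  (S.smooth_Z.pd S.isOpen_U I).differentiableAt_of_isOpen S.isOpen_U hp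

theorem differentiableAt_tangentMat {p : Event} (hp : p ∈ S.U) (a : Fin 3) (j : Fin 2) :
    DifferentiableAt ℝ (fun q => S.tangentMat q a j) p :=
  differentiableAt_euclidean.1 (S.differentiableAt_pd_Z hp j.succ) a

theorem g_eq (p : Event) : S.g p = (S.tangentMat p).transpose * S.tangentMat p := by
  ext i j
  simp [g, Matrix.mul_apply, tangentMat_apply, PiLp.inner_apply, mul_comm]

/-- The projected derivative of the tangent frame, `∇_w ∂_j Z = (connection w)^i_j ∂_i Z`. -/
def connection (p w : Event) : Matrix (Fin 2) (Fin 2) ℝ :=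
  (S.g p)⁻¹ * ((S.tangentMat p).transpose * matDeriv S.tangentMat p w)

theorem matDeriv_mul {ι κ μ : Type*} [Fintype κ] (M : Event → Matrix ι κ ℝ)
    (N : Event → Matrix κ μ ℝ) {p : Event} (hM : ∀ i j, DifferentiableAt ℝ (fun q => M q i j) p)
    (hN : ∀ i j, DifferentiableAt ℝ (fun q => N q i j) p) (w : Event) :
    matDeriv (fun q => M q * N q) p w = matDeriv M p w * N p + M p * matDeriv N p w := by
  ext i j
  simp only [matDeriv_apply, Matrix.mul_apply, Matrix.add_apply]
  rw [fderiv_sum_mul (f := fun k q => M q i k) (h := fun k q => N q k j) (hM i) (fun k => hN k j),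
    ← Finset.sum_add_distrib]
  refine Finset.sum_congr rfl fun k _ => ?_
  ring

theorem matDeriv_transpose {ι κ : Type*} (M : Event → Matrix ι κ ℝ) (p w : Event) :
    matDeriv (fun q => (M q).transpose) p w = (matDeriv M p w).transpose := rfl

/-- Product rule for `g = Tᵀ T`: the two terms are metric transposes of each other. -/
theorem inv_g_mul_matDeriv_g {p : Event} (hp : p ∈ S.U) (w : Event) :
    (S.g p)⁻¹ * matDeriv S.g p w = S.connection p w + S.tr p (S.connection p w) := by
  have h : matDeriv S.g p w = (matDeriv S.tangentMat p w).transpose * S.tangentMat p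
      + (S.tangentMat p).transpose * matDeriv S.tangentMat p w := by
    rw [funext S.g_eq, matDeriv_mul (fun q => (S.tangentMat q).transpose) _ (fun i j => S.differentiableAt_tangentMat hp j i)
      (S.differentiableAt_tangentMat hp), matDeriv_transpose]
  rw [h, mul_add, add_comm, connection, tr, Matrix.transpose_mul, Matrix.transpose_mul,
    Matrix.transpose_transpose, S.inv_g_transpose]
  congr 1
  rw [Matrix.mul_assoc, Matrix.mul_assoc _ _ (S.g p), S.inv_g_mul hp, Matrix.mul_one]

theorem connection_pd {p : Event} (hp : p ∈ S.U) (K : Fin 3) (i j : Fin 2) :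
    S.connection p (Pi.single K 1) i j
      = ∑ l, (S.g p)⁻¹ i l * inner ℝ (pd K (pd j.succ S.Z) p) (pd l.succ S.Z p) := by
  simp only [connection, Matrix.mul_apply, PiLp.inner_apply, Matrix.transpose_apply,
    tangentMat_apply, matDeriv_apply, fderiv_euclidean_apply (S.differentiableAt_pd_Z hp _)]
  simp [pd]

theorem connection_succ {p : Event} (hp : p ∈ S.U) (i j k : Fin 2) :
    S.connection p (Pi.single k.succ 1) i j = S.Gam p i k j := S.connection_pd hp _ _ _

theorem Gam_symm {p : Event} (hp : p ∈ S.U) (i j k : Fin 2) : S.Gam p i k j = S.Gam p i j k := by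
  simp only [Gam, pd_comm S.smooth_Z S.isOpen_U hp k.succ]

theorem inner_V_pd_pd {p : Event} (hp : p ∈ S.U) (i j : Fin 2) :
    inner ℝ (S.V p) (pd i.succ (pd j.succ S.Z) p)
      = (∑ k, S.v p k * inner ℝ (pd k.succ S.Z p) (pd i.succ (pd j.succ S.Z) p))
        + S.nu p * inner ℝ (pd i.succ (pd j.succ S.Z) p) (S.N p) := by
  rw [S.V_eq hp, inner_add_left, sum_inner, inner_smul_left,
    real_inner_comm (S.N p)]
  simp [inner_smul_left]

/-- Differentiate `⟨V, ∂_j Z⟩ = g_{jk} v^k` along `∂_i` and exchange `∂_t` with `∂_i`. Splitting `V`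
in `⟨V, ∂_i ∂_j Z⟩` leaves the term `ν II_{ij}`. -/
theorem inner_pd_V {p : Event} (hp : p ∈ S.U) (i j : Fin 2) :
    inner ℝ (pd 0 (pd i.succ S.Z) p) (pd j.succ S.Z p)
      = (∑ k, S.g p j k * pd i.succ (fun q => S.v q k) p)
        + (∑ k, S.v p k * inner ℝ (pd i.succ (pd k.succ S.Z) p) (pd j.succ S.Z p))
        - S.nu p * inner ℝ (pd i.succ (pd j.succ S.Z) p) (S.N p) := by
  have hV : DifferentiableAt ℝ S.V p := S.differentiableAt_pd_Z hp 0
  -- The identity holds on `S.U` only, so the derivatives are compared through equality near `p`.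
  have e : (fun q => inner ℝ (S.V q) (pd j.succ S.Z q))
      =ᶠ[nhds p] fun q => ∑ k, S.g q j k * S.v q k := by
    filter_upwards [S.isOpen_U.mem_nhds hp] with q hq using S.inner_V hq j
  have h1 := pd_inner hV (S.differentiableAt_pd_Z hp j.succ) i.succ
  have h2 : pd i.succ (fun q => inner ℝ (S.V q) (pd j.succ S.Z q)) p
      = ∑ k, (S.g p j k * pd i.succ (fun q => S.v q k) p
        + S.v p k * (inner ℝ (pd j.succ S.Z p) (pd i.succ (pd k.succ S.Z) p)
          + inner ℝ (pd i.succ (pd j.succ S.Z) p) (pd k.succ S.Z p))) := by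
    have h3 : pd i.succ (fun q => inner ℝ (S.V q) (pd j.succ S.Z q)) p
        = pd i.succ (fun q => ∑ k, S.g q j k * S.v q k) p :=
      congrArg (fun L : Event →L[ℝ] ℝ => L (Pi.single i.succ 1)) (e.fderiv_eq (𝕜 := ℝ))
    rw [h3, _root_.pd, fderiv_sum_mul (f := fun k q => S.g q j k) (h := fun k q => S.v q k)
      (fun k => (S.contDiffOn_g j k).differentiableAt_of_isOpen S.isOpen_U hp)
      (fun k => (S.contDiffOn_v k).differentiableAt_of_isOpen S.isOpen_U hp)]
    refine Finset.sum_congr rfl fun k _ => ?_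
    congr 2
    exact pd_inner (S.differentiableAt_pd_Z hp j.succ) (S.differentiableAt_pd_Z hp k.succ) i.succ
  rw [h2, S.inner_V_pd_pd hp] at h1
  have h4 : pd 0 (pd i.succ S.Z) p = pd i.succ S.V p := pd_comm S.smooth_Z S.isOpen_U hp _ _
  rw [h4]
  simp only [Fin.sum_univ_two] at h1 ⊢
  rw [real_inner_comm _ (pd i.succ (pd (Fin.succ 0) S.Z) p),
    real_inner_comm _ (pd i.succ (pd (Fin.succ 1) S.Z) p)]
  rw [real_inner_comm _ (pd i.succ (pd j.succ S.Z) p),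
    real_inner_comm _ (pd i.succ (pd j.succ S.Z) p)] at h1
  linarith

/-- Raising an index in `inner_pd_V` combines `∂_j v^i` with the Christoffel terms to `∇v`. This is
the source of `𝓑` in all the formulas. -/
theorem connection_zero {p : Event} (hp : p ∈ S.U) : S.connection p (Pi.single 0 1) = S.B p := by
  ext i j
  have hδ : ∀ k, ∑ l, (S.g p)⁻¹ i l * S.g p l k = (1 : Matrix (Fin 2) (Fin 2) ℝ) i k := fun k => by
    rw [← Matrix.mul_apply, S.inv_g_mul hp]
  have h : ∑ l, (S.g p)⁻¹ i l * (∑ k, S.g p l k * pd j.succ (fun q => S.v q k) p)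
      = pd j.succ (fun q => S.v q i) p := by
    simp only [Finset.mul_sum, ← mul_assoc]
    rw [Finset.sum_comm]
    simp only [← Finset.sum_mul, hδ]
    simp [Matrix.one_apply]
  rw [S.connection_pd hp]
  simp only [S.inner_pd_V hp, mul_sub, mul_add, Finset.sum_add_distrib, Finset.sum_sub_distrib]
  rw [h]
  simp only [B, grad, shape, Gam, Matrix.sub_apply, Matrix.smul_apply, smul_eq_mul,
    pd_comm S.smooth_Z S.isOpen_U hp j.succ]
  simp only [Fin.sum_univ_two]
  ring

end MovingSurface

theorem dotSlot_zero {n : ℕ} {ι : Type*} [Fintype ι] (l : Fin n)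
    (T : (Fin n → ι) → ℝ) (I : Fin n → ι) : dotSlot 0 l T I = 0 := by
  simp [dotSlot]

theorem dotSlot_sub {n : ℕ} {ι : Type*} [Fintype ι] (P Q : Matrix ι ι ℝ) (l : Fin n)
    (T : (Fin n → ι) → ℝ) (I : Fin n → ι) :
    dotSlot (P - Q) l T I = dotSlot P l T I - dotSlot Q l T I := by
  rw [sub_eq_add_neg, dotSlot_add, dotSlot_neg, sub_eq_add_neg]

theorem matDeriv_const {ι κ : Type*} (M : Matrix ι κ ℝ) (p w : Event) :
    matDeriv (fun _ => M) p w = 0 := by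
  ext i j
  simp [matDeriv_apply]

namespace MovingSurface

variable (S : MovingSurface)

/-! ### Directional derivatives -/

theorem matDir_eq (vm : Event → Fin 2 → ℝ) (p : Event) :
    S.matDir vm p = Pi.single 0 1 + ∑ k, S.relVel vm p k • Pi.single (Fin.succ k) 1 := by
  funext I
  fin_cases I <;> simp [matDir]
  rfl

theorem fderiv_matDir (vm : Event → Fin 2 → ℝ) (f : Event → ℝ) (p : Event) :
    fderiv ℝ f p (S.matDir vm p) = S.dotScalar vm f p := by
  rw [fderiv_eq_pd, Fin.sum_univ_succ]
  simp [dotScalar, matDir]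

theorem differentiableAt_g {p : Event} (hp : p ∈ S.U) (i j : Fin 2) :
    DifferentiableAt ℝ (fun q => S.g q i j) p :=
  (S.contDiffOn_g i j).differentiableAt_of_isOpen S.isOpen_U hp

theorem differentiableAt_v {p : Event} (hp : p ∈ S.U) (i : Fin 2) :
    DifferentiableAt ℝ (fun q => S.v q i) p :=
  (S.contDiffOn_v i).differentiableAt_of_isOpen S.isOpen_U hp

theorem differentiableAt_nu {p : Event} (hp : p ∈ S.U) : DifferentiableAt ℝ S.nu p :=
  S.contDiffOn_nu.differentiableAt_of_isOpen S.isOpen_U hp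

/-- Linearity in the direction `∂_t + u^k ∂_k`. By symmetry of the Christoffel symbols, `u^k
Γ^i_{kj}` is the non-derivative part of `∇u`. -/
theorem connection_matDir {p : Event} (hp : p ∈ S.U) (vm : Event → Fin 2 → ℝ) :
    S.connection p (S.matDir vm p)
      = S.B p + (S.grad (S.relVel vm) p - jac Fin.succ (S.relVel vm) p) := by
  have h : S.connection p (S.matDir vm p) = S.connection p (Pi.single 0 1)
      + ∑ k, S.relVel vm p k • S.connection p (Pi.single k.succ 1) := by
    have h1 : matDeriv S.tangentMat p (S.matDir vm p) = matDeriv S.tangentMat p (Pi.single 0 1)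
        + ∑ k, S.relVel vm p k • matDeriv S.tangentMat p (Pi.single (Fin.succ k) 1) := by
      ext a j
      simp [matDeriv_apply, S.matDir_eq, map_add, map_smul]
    simp only [connection, h1, Matrix.mul_add, Matrix.mul_sum, Matrix.mul_smul]
  rw [h, S.connection_zero hp]
  congr 1
  ext i j
  simp only [Matrix.sum_apply, Matrix.smul_apply, smul_eq_mul, S.connection_succ hp,
    Matrix.sub_apply, grad, jac_apply, add_sub_cancel_left]
  refine Finset.sum_congr rfl fun k _ => ?_
  rw [S.Gam_symm hp, mul_comm]

theorem nablaDir_relVel {p : Event} (hp : p ∈ S.U) (vm : Event → Fin 2 → ℝ) {m : ℕ}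
    (r : SurfaceField m) (i : Fin m → Fin 2) :
    pd 0 (fun q => r q i) p + S.nablaDir (S.relVel vm) r p i
      = fderiv ℝ (fun q => r q i) p (S.matDir vm p)
        + ∑ β, dotSlot (S.grad (S.relVel vm) p - jac Fin.succ (S.relVel vm) p) β (r p) i := by
  rw [S.fderiv_matDir, dotScalar, nablaDir, add_assoc]
  simp only [mul_add, Finset.sum_add_distrib, Finset.mul_sum]
  congr 2
  rw [Finset.sum_comm]
  refine Finset.sum_congr rfl fun β _ => ?_
  rw [Finset.sum_comm]
  refine Finset.sum_congr rfl fun j _ => ?_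
  simp only [Matrix.sub_apply, grad, jac_apply, add_sub_cancel_left, Finset.sum_mul]
  refine Finset.sum_congr rfl fun k _ => ?_
  rw [S.Gam_symm hp]
  ring

theorem tr_add (p : Event) (P Q : Matrix (Fin 2) (Fin 2) ℝ) :
    S.tr p (P + Q) = S.tr p P + S.tr p Q := by
  simp [tr, mul_add, add_mul]

theorem tr_sub (p : Event) (P Q : Matrix (Fin 2) (Fin 2) ℝ) :
    S.tr p (P - Q) = S.tr p P - S.tr p Q := by
  simp [tr, mul_sub, sub_mul]

theorem Bm_eq {p : Event} (hp : p ∈ S.U) {vm : Event → Fin 2 → ℝ}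
    (hvm : ∀ i, DifferentiableAt ℝ (fun q => vm q i) p) :
    S.Bm vm p = S.grad (S.relVel vm) p + S.B p := by
  ext i k
  have h : pd k.succ (fun q => S.relVel vm q i) p
      = pd k.succ (fun q => vm q i) p - pd k.succ (fun q => S.v q i) p := by
    have := ((hvm i).hasFDerivAt.fun_sub (S.differentiableAt_v hp i).hasFDerivAt).fderiv
    exact congrArg (fun L : Event →L[ℝ] ℝ => L (Pi.single k.succ 1)) this
  simp only [Bm, B, Matrix.sub_apply, Matrix.add_apply, grad, h]
  simp only [relVel, mul_sub, Finset.sum_sub_distrib]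
  ring

/-! ### Derivatives of surface tensors -/

section Surface

variable {S} {p : Event} {m a b : ℕ} {r : SurfaceField m}

theorem pick_mul_pick (hp : p ∈ S.U) (τ : Shuffle m a b) (l : Fin m) :
    τ.pick 1 (S.g p)⁻¹ l * τ.pick 1 (S.g p) l = 1 := by
  rw [τ.pick_eq, τ.pick_eq]
  split_ifs
  · simp
  · exact S.inv_g_mul hp

theorem differentiableAt_pick (hp : p ∈ S.U) (τ : Shuffle m a b) (l : Fin m) (i j : Fin 2) :
    DifferentiableAt ℝ (fun q => τ.pick 1 (S.g q) l i j) p := by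
  simp only [τ.pick_eq]
  split_ifs
  · exact differentiableAt_const _
  · exact S.differentiableAt_g hp i j

/-- The change of frame here is the lowering itself: trivial in upper slots, the metric in lowered
ones. -/
theorem pick_mul_matDeriv_pick (hp : p ∈ S.U) (τ : Shuffle m a b) (l : Fin m) (w : Event) :
    τ.pick 1 (S.g p)⁻¹ l * matDeriv (fun q => τ.pick 1 (S.g q) l) p w
      = if τ.InFront l then 0 else S.connection p w + S.tr p (S.connection p w) := by
  simp only [τ.pick_eq]
  split_ifs
  · rw [matDeriv_const, mul_zero]
  · exact S.inv_g_mul_matDeriv_g hp w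

theorem dtShuffled_eq (hp : p ∈ S.U) (hr : ∀ i, DifferentiableAt ℝ (fun q => r q i) p)
    (τ : Shuffle m a b) (i : Fin m → Fin 2) :
    S.dtShuffled τ r p i = pd 0 (fun q => r q i) p
      + ∑ β, dotSlot (if τ.InFront β then 0 else S.B p + S.tr p (S.B p)) β (r p) i := by
  have h := contract_fderiv_contract (τ.pick 1 (S.g p)⁻¹) (fun l q => τ.pick 1 (S.g q) l) r p
    (Pi.single 0 1) (differentiableAt_pick hp τ) hr (pick_mul_pick hp τ) i
  simp only [pick_mul_matDeriv_pick hp, S.connection_zero hp] at h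
  exact h

/-- `contract_lie_contract` with frame `1` or `g`; conjugating the transposed Jacobian with `g`
gives its metric transpose. -/
theorem instConv_eq (hp : p ∈ S.U) (hr : ∀ i, DifferentiableAt ℝ (fun q => r q i) p)
    (vm : Event → Fin 2 → ℝ) (τ : Shuffle m a b) (i : Fin m → Fin 2) :
    S.instConv vm τ r p i = fderiv ℝ (fun q => r q i) p (S.matDir vm p)
      + ∑ β, dotSlot (if τ.InFront β then -jac Fin.succ (S.relVel vm) p
          else S.connection p (S.matDir vm p) + S.tr p (S.connection p (S.matDir vm p))
            + S.tr p (jac Fin.succ (S.relVel vm) p)) β (r p) i := by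
  have h := contract_lie_contract (τ.pick 1 (S.g p)⁻¹) (fun l q => τ.pick 1 (S.g q) l)
    (fun l => if τ.InFront l then -jac Fin.succ (S.relVel vm) p
      else (jac Fin.succ (S.relVel vm) p).transpose) r p
    (S.matDir vm p) (differentiableAt_pick hp τ) hr (pick_mul_pick hp τ) i
  simp only [pick_mul_matDeriv_pick hp] at h
  have h2 : S.instConv vm τ r p i = contract (τ.pick 1 (S.g p)⁻¹)
      (fun J => fderiv ℝ (fun q => contract (fun l => τ.pick 1 (S.g q) l) (r q) J) p
          (S.matDir vm p)
        + ∑ l, dotSlot (if τ.InFront l then -jac Fin.succ (S.relVel vm) p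
            else (jac Fin.succ (S.relVel vm) p).transpose) l
          (contract (fun l => τ.pick 1 (S.g p) l) (r p)) J) i := by
    rw [instConv, sharp, slotwise_eq_contract]
    congr 1
    funext J
    rw [lieDeriv_eq, S.matDir_eq, map_add, pd, add_assoc]
    rfl
  rw [h2, h]
  congr 1
  refine Finset.sum_congr rfl fun l _ => ?_
  congr 1
  rw [τ.pick_eq, τ.pick_eq]
  split_ifs
  · simp
  · simp [tr, Matrix.mul_assoc]

/-- Orthogonal projection followed by taking components is `g⁻¹ Tᵀ`, a left inverse of `T`, so the
conjugation lemma applies. -/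
theorem dot_eq (hp : p ∈ S.U) (hr : ∀ i, DifferentiableAt ℝ (fun q => r q i) p)
    (vm : Event → Fin 2 → ℝ) (i : Fin m → Fin 2) :
    S.dot vm r p i = fderiv ℝ (fun q => r q i) p (S.matDir vm p)
      + ∑ β, dotSlot (S.connection p (S.matDir vm p)) β (r p) i := by
  have h := contract_fderiv_contract (fun _ => (S.g p)⁻¹ * (S.tangentMat p).transpose)
    (fun _ q => S.tangentMat q) r p (S.matDir vm p)
    (fun _ => S.differentiableAt_tangentMat hp) hr
    (fun _ => by rw [Matrix.mul_assoc, ← S.g_eq, S.inv_g_mul hp]) i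
  simp only [Matrix.mul_assoc] at h
  simp only [connection]
  rw [← h]
  simp only [dot, contract, S.fderiv_matDir, euclid, mul_comm (r _ _)]
  rfl

end Surface

/-! ### The curl -/

/-- After lowering, `II` is symmetric and cancels. The antisymmetric part of `∇v_𝔪` is a `2 × 2`
skew matrix, hence a multiple of `ε`, and the factor is `-rot v_𝔪`. -/
theorem Bm_sub_tr {p : Event} (hp : p ∈ S.U) (vm : Event → Fin 2 → ℝ) :
    S.Bm vm p - S.tr p (S.Bm vm p) = (-S.rot vm p) • ((S.g p)⁻¹ * S.eps p) := by
  have hdet := S.det_g_pos hp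
  have hs : Real.sqrt (S.g p).det * Real.sqrt (S.g p).det = (S.g p).det :=
    Real.mul_self_sqrt hdet.le
  have hshape : S.g p * S.shape p
      = Matrix.of fun i j => inner ℝ (pd i.succ (pd j.succ S.Z) p) (S.N p) := by
    have : S.shape p = (S.g p)⁻¹ *
      Matrix.of fun i j => inner ℝ (pd i.succ (pd j.succ S.Z) p) (S.N p) := by
      ext i j
      rfl
    rw [this, ← Matrix.mul_assoc, S.g_mul_inv hp, Matrix.one_mul]
  have hsymm : (S.shape p).transpose * S.g p = S.g p * S.shape p := by
    have h := congrArg Matrix.transpose hshape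
    rw [Matrix.transpose_mul, S.g_transpose] at h
    rw [h, hshape]
    ext i j
    simp [pd_comm S.smooth_Z S.isOpen_U hp i.succ]
  have h1 : S.g p * S.Bm vm p - (S.Bm vm p).transpose * S.g p
      = S.g p * S.grad vm p - (S.grad vm p).transpose * S.g p := by
    rw [Bm, mul_sub, Matrix.transpose_sub, sub_mul, Matrix.transpose_smul, Matrix.smul_mul, hsymm,
      Matrix.mul_smul]
    abel
  have h2 : S.g p * S.grad vm p - (S.grad vm p).transpose * S.g p = (-S.rot vm p) • S.eps p := by
    have hinv : (S.g p)⁻¹ = ((S.g p).det)⁻¹ • (S.g p).adjugate := by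
      simp [Matrix.inv_def]
    -- Multiplying by the square root cancels the `1 / det g` of the inverse metric against the two
    -- square roots.
    have hrot : S.rot vm p * Real.sqrt (S.g p).det =
        -(S.g p 0 0 * S.grad vm p 0 1 + S.g p 0 1 * S.grad vm p 1 1
          - S.g p 0 1 * S.grad vm p 0 0 - S.g p 1 1 * S.grad vm p 1 0) := by
      have e : S.rot vm p = -(((S.g p).det)⁻¹ * Real.sqrt (S.g p).det *
          (S.g p 0 0 * S.grad vm p 0 1 + S.g p 0 1 * S.grad vm p 1 1
          - S.g p 0 1 * S.grad vm p 0 0 - S.g p 1 1 * S.grad vm p 1 0)) := by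
        simp only [rot, hinv, eps, Fin.sum_univ_two, Matrix.smul_apply, smul_eq_mul,
          Matrix.adjugate_fin_two, S.g_symm p 1 0]
        simp
        ring
      rw [e]
      have : ((S.g p).det)⁻¹ * (Real.sqrt (S.g p).det * Real.sqrt (S.g p).det) = 1 := by
        rw [hs, inv_mul_cancel₀ hdet.ne']
      linear_combination (-(S.g p 0 0 * S.grad vm p 0 1 + S.g p 0 1 * S.grad vm p 1 1
          - S.g p 0 1 * S.grad vm p 0 0 - S.g p 1 1 * S.grad vm p 1 0)) * this
    ext i j
    simp only [Matrix.sub_apply, Matrix.mul_apply, Matrix.transpose_apply, Fin.sum_univ_two,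
      Matrix.smul_apply, smul_eq_mul, eps]
    fin_cases i <;> fin_cases j <;> simp [S.g_symm p 1 0]
    · ring
    · linear_combination hrot
    · linear_combination -hrot
    · ring
  calc S.Bm vm p - S.tr p (S.Bm vm p)
      = (S.g p)⁻¹ * (S.g p * S.Bm vm p - (S.Bm vm p).transpose * S.g p) := by
        rw [mul_sub, ← Matrix.mul_assoc, S.inv_g_mul hp, Matrix.one_mul, tr, Matrix.mul_assoc]
    _ = _ := by rw [h1, h2, Matrix.mul_smul]

end MovingSurface

/-! ### Extension by zero as a contraction -/

theorem extendZero_eq {m : ℕ} (r : (Fin m → Fin 2) → ℝ) (I : Fin m → Fin 3) :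
    MovingSurface.extendZero r I
      = ∑ i : Fin m → Fin 2, (∏ b, if I b = (i b).succ then 1 else 0) * r i := by
  unfold MovingSurface.extendZero
  split_ifs with h
  · rw [Finset.sum_eq_single fun b => (I b).pred (h b)]
    · simp
    · intro i _ hi
      obtain ⟨b, hb⟩ := Function.ne_iff.1 hi
      rw [Finset.prod_eq_zero (Finset.mem_univ b), zero_mul]
      rw [if_neg]
      intro e
      apply hb
      simp [e]
    · simp
  · push Not at h
    obtain ⟨b, hb⟩ := h
    symm
    refine Finset.sum_eq_zero fun i _ => ?_
    rw [Finset.prod_eq_zero (Finset.mem_univ b), zero_mul]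
    rw [hb, if_neg (Fin.succ_ne_zero _).symm]

namespace MovingSurface

variable (S : MovingSurface)

/-! ### The adapted spacetime frame -/

/-- The frame `(τ, ∂_1 X, ∂_2 X)`. -/
def frameMat (p : Event) : Matrix (Fin 3) (Fin 3) ℝ :=
  !![1, 0, 0; -S.v p 0, 1, 0; -S.v p 1, 0, 1]

/-- The dual frame. -/
def coframeMat (p : Event) : Matrix (Fin 3) (Fin 3) ℝ :=
  !![1, 0, 0; S.v p 0, 1, 0; S.v p 1, 0, 1]

/-- The spacetime metric in the adapted frame. -/
def frameMetric (p : Event) : Matrix (Fin 3) (Fin 3) ℝ :=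
  !![1 + S.nu p ^ 2, 0, 0; 0, S.g p 0 0, S.g p 0 1; 0, S.g p 1 0, S.g p 1 1]

/-- The inverse spacetime metric in the adapted frame. -/
def frameMetricInv (p : Event) : Matrix (Fin 3) (Fin 3) ℝ :=
  !![S.zeta p, 0, 0; 0, (S.g p)⁻¹ 0 0, (S.g p)⁻¹ 0 1; 0, (S.g p)⁻¹ 1 0, (S.g p)⁻¹ 1 1]

theorem zeta_mul (p : Event) : S.zeta p * (1 + S.nu p ^ 2) = 1 := by
  have : 1 + S.nu p ^ 2 ≠ 0 := by positivity
  unfold zeta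
  field_simp

theorem tau_zero (p : Event) : S.tau p 0 = 1 := rfl

theorem tau_one (p : Event) : S.tau p 1 = -S.v p 0 := rfl

theorem tau_two (p : Event) : S.tau p 2 = -S.v p 1 := rfl

theorem frameMat_zero (p : Event) (I : Fin 3) : S.frameMat p I 0 = S.tau p I := by
  fin_cases I <;> simp [frameMat, tau_zero, tau_one, tau_two]

theorem frameMat_succ (p : Event) (I : Fin 3) (j : Fin 2) :
    S.frameMat p I j.succ = if I = j.succ then 1 else 0 := by
  fin_cases I <;> fin_cases j <;> simp [frameMat]

theorem coframe_mul_frame (p : Event) : S.coframeMat p * S.frameMat p = 1 := by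
  ext I J
  fin_cases I <;> fin_cases J <;> simp [coframeMat, frameMat, Matrix.mul_apply, Fin.sum_univ_three]

theorem frame_mul_coframe (p : Event) : S.frameMat p * S.coframeMat p = 1 :=
  mul_eq_one_comm.1 (S.coframe_mul_frame p)

theorem frameMetricInv_mul {p : Event} (hp : p ∈ S.U) :
    S.frameMetricInv p * S.frameMetric p = 1 := by
  have h : ∀ i j, ∑ k, (S.g p)⁻¹ i k * S.g p k j = (1 : Matrix (Fin 2) (Fin 2) ℝ) i j :=
    fun i j => by rw [← Matrix.mul_apply, S.inv_g_mul hp]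
  simp only [Fin.sum_univ_two] at h
  ext I J
  fin_cases I <;> fin_cases J <;>
    simp [frameMetricInv, frameMetric, Matrix.mul_apply, Fin.sum_univ_three, S.zeta_mul, h]

theorem eta_apply {p : Event} (hp : p ∈ S.U) (I J : Fin 3) :
    S.eta p I J = (if I = 0 ∧ J = 0 then 1 else 0) + inner ℝ (pd I S.Z p) (pd J S.Z p) := by
  have hZ : DifferentiableAt ℝ S.Z p := S.smooth_Z.differentiableAt_of_isOpen S.isOpen_U hp
  have hZa : ∀ a, DifferentiableAt ℝ (fun q => S.Z q a) p := differentiableAt_euclidean.1 hZ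
  have h0 : (fun q => S.X q 0) = fun q : Event => q 0 := rfl
  have hs : ∀ a : Fin 3, (fun q => S.X q a.succ) = fun q : Event => S.Z q a := fun a => rfl
  have hX : DifferentiableAt ℝ S.X p := by
    rw [differentiableAt_euclidean]
    intro a
    refine Fin.cases ?_ (fun a => ?_) a
    · rw [h0]; fun_prop
    · rw [hs]; exact hZa a
  have e0 : ∀ K : Fin 3, pd K S.X p 0 = if K = 0 then 1 else 0 := by
    intro K
    have h1 : pd K S.X p 0 = fderiv ℝ (fun q => S.X q 0) p (Pi.single K 1) :=
      (fderiv_euclidean_apply hX _ _).symm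
    have h2 : fderiv ℝ (fun q : Event => q 0) p
        = ContinuousLinearMap.proj (R := ℝ) (φ := fun _ : Fin 3 => ℝ) 0 :=
      (ContinuousLinearMap.proj (R := ℝ) (φ := fun _ : Fin 3 => ℝ) 0).fderiv
    rw [h1, h0, h2]
    simp [Pi.single_apply, eq_comm]
  have es : ∀ (K a : Fin 3), pd K S.X p a.succ = pd K S.Z p a := by
    intro K a
    have h1 : pd K S.X p a.succ = fderiv ℝ (fun q => S.X q a.succ) p (Pi.single K 1) :=
      (fderiv_euclidean_apply hX _ _).symm
    rw [h1, hs]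
    exact fderiv_euclidean_apply hZ _ _
  simp only [eta, PiLp.inner_apply]
  rw [Fin.sum_univ_succ]
  simp only [e0, es]
  congr 1
  by_cases hI : I = 0 <;> by_cases hJ : J = 0 <;> simp [hI, hJ]

/-- `τ` is `η`-orthogonal to both `∂_i X` because subtracting `v` removes the tangential part of
`V`. Its square length is `1` from the time coordinate plus `ν²`. -/
theorem eta_eq {p : Event} (hp : p ∈ S.U) :
    S.eta p = (S.coframeMat p).transpose * S.frameMetric p * S.coframeMat p := by
  have hj := S.inner_V hp
  have hN : inner ℝ (S.V p) (S.N p) = S.nu p := rfl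
  have hVV : inner ℝ (S.V p) (S.V p)
      = (∑ k, S.v p k * ∑ l, S.g p k l * S.v p l) + S.nu p ^ 2 := by
    have h := congrArg (inner ℝ (S.V p)) (S.V_eq hp)
    rw [inner_add_right, inner_sum, real_inner_smul_right, hN] at h
    simp only [real_inner_smul_right, hj] at h
    rw [h, sq]
  simp only [Fin.sum_univ_two] at hVV hj
  have h00 : S.eta p 0 0 = 1 + inner ℝ (S.V p) (S.V p) := by rw [S.eta_apply hp]; simp [V]
  have h0s : ∀ j : Fin 2, S.eta p 0 j.succ = inner ℝ (S.V p) (pd j.succ S.Z p) := fun j => by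
    rw [S.eta_apply hp]; simp [V]
  have hs0 : ∀ j : Fin 2, S.eta p j.succ 0 = inner ℝ (S.V p) (pd j.succ S.Z p) := fun j => by
    rw [S.eta_apply hp, real_inner_comm]; simp [V]
  have hss : ∀ i j : Fin 2, S.eta p i.succ j.succ = S.g p i j := fun i j => by
    rw [S.eta_apply hp]; simp [g]
  ext I J
  refine Fin.cases ?_ (fun i => ?_) I <;> refine Fin.cases ?_ (fun j => ?_) J
  · rw [h00, hVV]
    simp [coframeMat, frameMetric, Matrix.mul_apply, Fin.sum_univ_three]
    ring
  · rw [h0s, hj]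
    fin_cases j <;> simp [coframeMat, frameMetric, Matrix.mul_apply, Fin.sum_univ_three,
      S.g_symm p 1 0] <;> ring
  · rw [hs0, hj]
    fin_cases i <;> simp [coframeMat, frameMetric, Matrix.mul_apply, Fin.sum_univ_three]
  · rw [hss]
    fin_cases i <;> fin_cases j <;>
      simp [coframeMat, frameMetric, Matrix.mul_apply, Fin.sum_univ_three]

/-- Supplies the left factor in a lowered slot, where raising with `η⁻¹` is followed by `bracket`.
-/
theorem coframe_mul_inv_eta {p : Event} (hp : p ∈ S.U) :
    S.coframeMat p * (S.eta p)⁻¹ = S.frameMetricInv p * (S.frameMat p).transpose := by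
  have h : (S.frameMat p * S.frameMetricInv p * (S.frameMat p).transpose) * S.eta p = 1 := by
    rw [S.eta_eq hp]
    calc _ = S.frameMat p * (S.frameMetricInv p * ((S.coframeMat p * S.frameMat p).transpose
          * S.frameMetric p)) * S.coframeMat p := by
            rw [Matrix.transpose_mul]; simp only [Matrix.mul_assoc]
      _ = 1 := by
        rw [S.coframe_mul_frame, Matrix.transpose_one, Matrix.one_mul, S.frameMetricInv_mul hp,
          Matrix.mul_one, S.frame_mul_coframe]
  rw [Matrix.inv_eq_left_inv h, ← Matrix.mul_assoc, ← Matrix.mul_assoc, S.coframe_mul_frame,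
    Matrix.one_mul]

theorem tauLow_eq {p : Event} (hp : p ∈ S.U) (I : Fin 3) :
    S.tauLow p I = if I = 0 then 1 + S.nu p ^ 2 else 0 := by
  have h : S.tauLow p I = ((S.coframeMat p).transpose * S.frameMetric p) I 0 := by
    have h1 : S.eta p * S.frameMat p = (S.coframeMat p).transpose * S.frameMetric p := by
      rw [S.eta_eq hp, Matrix.mul_assoc, S.coframe_mul_frame, Matrix.mul_one]
    rw [← h1, Matrix.mul_apply]
    simp only [S.frameMat_zero]
    rfl
  rw [h]
  fin_cases I <;> simp [coframeMat, frameMetric, Matrix.mul_apply, Fin.sum_univ_three]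

/-- Testing the transversal projection with `ζ τ` yields `dt`, as `τ_I` is `1 + ν²` times `dt`. The
spatial rows of the instantaneous projection are the other two rows of the coframe. -/
theorem bracket_eq {p : Event} (hp : p ∈ S.U) {n α m : ℕ} (R : SpacetimeField n)
    (σ : Shuffle n α m) (i : Fin m → Fin 2) :
    S.bracket R σ p i = contract (fun _ => S.coframeMat p) (R p) (σ.frameIdx i) := by
  have h1 : ∀ J : Fin 3, ∑ K, S.zeta p * S.tauLow p K * S.projTrans p K J
      = S.coframeMat p 0 J := by
    intro J
    simp only [S.tauLow_eq hp, Fin.sum_univ_succ (n := 2), Fin.succ_ne_zero, if_true, if_false,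
      mul_zero, zero_mul, Finset.sum_const_zero, add_zero, S.zeta_mul, one_mul]
    fin_cases J <;> simp [projTrans, coframeMat, tau_zero]
  have h2 : ∀ (k : Fin 2) (J : Fin 3), S.projInst p k.succ J = S.coframeMat p k.succ J := by
    intro k J
    fin_cases k <;> fin_cases J <;> simp [projInst, projTrans, coframeMat, tau_one, tau_two]
  simp only [bracket, slotwise, contract, Finset.mul_sum]
  rw [Finset.sum_comm]
  refine Finset.sum_congr rfl fun J _ => ?_
  simp only [σ.prod_eq, σ.pick_front, σ.pick_rear, σ.join_front, σ.join_rear, h2,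
    σ.frameIdx_front, σ.frameIdx_rear, ← h1]
  rw [Finset.prod_univ_sum, Fintype.piFinset_univ, Finset.sum_mul, Finset.sum_mul]
  refine Finset.sum_congr rfl fun K _ => ?_
  simp only [Finset.prod_mul_distrib]
  ring

theorem unbracket_eq {n : ℕ} (r : BundleField n) (p : Event) :
    S.unbracket r p = contract (fun _ => S.frameMat p) (BundleField.frame r p) := by
  funext I
  rw [contract, ← Shuffle.sum_frameIdx]
  refine Finset.sum_congr rfl fun x _ => Finset.sum_congr rfl fun σ _ => ?_
  rw [extendZero_eq, Finset.mul_sum]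
  refine Finset.sum_congr rfl fun i _ => ?_
  simp only [σ.prod_eq, σ.frameIdx_front, σ.frameIdx_rear, S.frameMat_zero, S.frameMat_succ,
    BundleField.frame_frameIdx]
  ring

end MovingSurface

namespace MovingSurface

variable (S : MovingSurface)

/-! ### Convected derivatives in the adapted frame -/

/-- The coefficients `[τ_𝔪, e_J]^I` of the upper convected derivative in the adapted frame `e`. -/
def upperCoeff (vm : Event → Fin 2 → ℝ) (p : Event) : Matrix (Fin 3) (Fin 3) ℝ :=
  S.coframeMat p * matDeriv S.frameMat p (S.matDir vm p)
    - S.coframeMat p * jac id (S.matDir vm) p * S.frameMat p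

/-- The coefficients of the lower convected derivative in the adapted frame. -/
def lowerCoeff (vm : Event → Fin 2 → ℝ) (p : Event) : Matrix (Fin 3) (Fin 3) ℝ :=
  S.frameMetricInv p * matDeriv S.frameMetric p (S.matDir vm p)
    - S.frameMetricInv p * (S.upperCoeff vm p).transpose * S.frameMetric p

section

variable {S} {p : Event}

theorem differentiableAt_frameMat (hp : p ∈ S.U) (I J : Fin 3) :
    DifferentiableAt ℝ (fun q => S.frameMat q I J) p := by
  have h := S.differentiableAt_v hp
  fin_cases I <;> fin_cases J <;> simp [frameMat, h]

theorem differentiableAt_coframeMat (hp : p ∈ S.U) (I J : Fin 3) :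
    DifferentiableAt ℝ (fun q => S.coframeMat q I J) p := by
  have h := S.differentiableAt_v hp
  fin_cases I <;> fin_cases J <;> simp [coframeMat, h]

theorem differentiableAt_frameMetric (hp : p ∈ S.U) (I J : Fin 3) :
    DifferentiableAt ℝ (fun q => S.frameMetric q I J) p := by
  have h := S.differentiableAt_g hp
  have hn : DifferentiableAt ℝ (fun q => 1 + S.nu q ^ 2) p :=
    ((S.differentiableAt_nu hp).pow 2).const_add 1
  fin_cases I <;> fin_cases J <;> first | exact hn | simp [frameMetric, h]

theorem matDeriv_coframe_mul (hp : p ∈ S.U) (w : Event) :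
    matDeriv S.coframeMat p w * S.frameMat p = -(S.coframeMat p * matDeriv S.frameMat p w) := by
  have h := matDeriv_mul S.coframeMat S.frameMat (differentiableAt_coframeMat hp)
    (differentiableAt_frameMat hp) w
  rw [funext S.coframe_mul_frame, matDeriv_const] at h
  exact eq_neg_of_add_eq_zero_left h.symm

/-- In a lowered slot the frame is the coframe transposed times the frame metric. Trading the
derivative of the coframe for that of the frame produces `upperCoeff` transposed. -/
theorem lowerCoeff_eq (hp : p ∈ S.U) (vm : Event → Fin 2 → ℝ) :
    S.frameMetricInv p * (S.frameMat p).transpose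
        * matDeriv (fun q => (S.coframeMat q).transpose * S.frameMetric q) p (S.matDir vm p)
      + S.frameMetricInv p * (S.frameMat p).transpose * (jac id (S.matDir vm) p).transpose
        * ((S.coframeMat p).transpose * S.frameMetric p) = S.lowerCoeff vm p := by
  have h1 := congrArg Matrix.transpose (S.coframe_mul_frame p)
  have h2 := congrArg Matrix.transpose (matDeriv_coframe_mul hp (S.matDir vm p))
  rw [Matrix.transpose_mul, Matrix.transpose_one] at h1
  rw [Matrix.transpose_mul] at h2
  have h3 := matDeriv_mul (fun q => (S.coframeMat q).transpose) S.frameMetric (p := p)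
    (fun i j => differentiableAt_coframeMat hp j i) (differentiableAt_frameMetric hp)
    (S.matDir vm p)
  rw [matDeriv_transpose] at h3
  rw [h3, lowerCoeff, upperCoeff]
  have e1 : S.frameMetricInv p * (S.frameMat p).transpose
      * ((matDeriv S.coframeMat p (S.matDir vm p)).transpose * S.frameMetric p
        + (S.coframeMat p).transpose * matDeriv S.frameMetric p (S.matDir vm p))
      = S.frameMetricInv p * ((S.frameMat p).transpose
        * (matDeriv S.coframeMat p (S.matDir vm p)).transpose) * S.frameMetric p
      + S.frameMetricInv p * ((S.frameMat p).transpose * (S.coframeMat p).transpose)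
        * matDeriv S.frameMetric p (S.matDir vm p) := by
    simp only [mul_add, Matrix.mul_assoc]
  have e2 : S.frameMetricInv p * (S.frameMat p).transpose * (jac id (S.matDir vm) p).transpose
        * ((S.coframeMat p).transpose * S.frameMetric p)
      = S.frameMetricInv p * (S.coframeMat p * jac id (S.matDir vm) p * S.frameMat p).transpose
        * S.frameMetric p := by
    simp only [Matrix.transpose_mul, Matrix.mul_assoc]
  rw [e1, e2, h1, h2, Matrix.transpose_sub, mul_sub, sub_mul, mul_one, Matrix.transpose_neg]
  simp only [mul_neg, neg_mul]
  abel

/-- The spacetime derivative as a conjugated Lie derivative: lowering composed with `unbracket` is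
the frame change, `bracket` composed with raising its left inverse. -/
theorem conv_frame (hp : p ∈ S.U) {n a b α m : ℕ} {r : BundleField n}
    (hr : ∀ (α m : ℕ) (σ : Shuffle n α m) (i : Fin m → Fin 2),
      DifferentiableAt ℝ (fun q => r σ q i) p) (vm : Event → Fin 2 → ℝ)
    (τ : Shuffle n a b) (σ : Shuffle n α m) (i : Fin m → Fin 2) :
    S.conv vm τ r σ p i = fderiv ℝ (fun q => r σ q i) p (S.matDir vm p)
      + ∑ l, dotSlot (if τ.InFront l then S.upperCoeff vm p else S.lowerCoeff vm p) l
          (BundleField.frame r p) (σ.frameIdx i) := by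
  have hNM : ∀ l, (if τ.InFront l then S.coframeMat p
      else S.frameMetricInv p * (S.frameMat p).transpose)
      * (if τ.InFront l then S.frameMat p else (S.coframeMat p).transpose * S.frameMetric p)
      = 1 := by
    intro l
    split_ifs
    · exact S.coframe_mul_frame p
    · rw [Matrix.mul_assoc, ← Matrix.mul_assoc _ _ (S.frameMetric p), ← Matrix.transpose_mul,
        S.coframe_mul_frame, Matrix.transpose_one, Matrix.one_mul, S.frameMetricInv_mul hp]
  have hN : ∀ (l : Fin n) (I J : Fin 3), DifferentiableAt ℝ (fun q => (if τ.InFront l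
      then S.frameMat q else (S.coframeMat q).transpose * S.frameMetric q) I J) p := by
    intro l I J
    split_ifs
    · exact differentiableAt_frameMat hp I J
    · simp only [Matrix.mul_apply, Matrix.transpose_apply]
      exact DifferentiableAt.fun_sum fun K _ => (differentiableAt_coframeMat hp K I).mul
        (differentiableAt_frameMetric hp K J)
  have h := contract_lie_contract (fun l => if τ.InFront l then S.coframeMat p
      else S.frameMetricInv p * (S.frameMat p).transpose)
    (fun l q => if τ.InFront l then S.frameMat q
      else (S.coframeMat q).transpose * S.frameMetric q)
    (fun l => if τ.InFront l then -jac id (S.matDir vm) p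
      else (jac id (S.matDir vm) p).transpose) (BundleField.frame r) p
    (S.matDir vm p) hN (fun J => hr _ _ _ _) hNM (σ.frameIdx i)
  have hflat : ∀ q ∈ S.U, S.flatST τ (S.unbracket r) q
      = contract (fun l => if τ.InFront l then S.frameMat q
          else (S.coframeMat q).transpose * S.frameMetric q) (BundleField.frame r q) := by
    intro q hq
    rw [flatST, slotwise_eq_contract, S.unbracket_eq, contract_contract]
    congr 1
    funext l
    rw [τ.pick_eq]
    split_ifs
    · exact Matrix.one_mul _
    · rw [S.eta_eq hq, Matrix.mul_assoc, S.coframe_mul_frame, Matrix.mul_one]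
  have hw : (∑ K, S.matDir vm p K • Pi.single (id K) 1 : Event) = S.matDir vm p :=
    (pi_eq_sum_univ' _).symm
  have hlie : S.conv vm τ r σ p i = contract (fun l => if τ.InFront l then S.coframeMat p
      else S.frameMetricInv p * (S.frameMat p).transpose)
      (fun J => fderiv ℝ (fun q => contract (fun l => if τ.InFront l then S.frameMat q
          else (S.coframeMat q).transpose * S.frameMetric q) (BundleField.frame r q) J) p
          (S.matDir vm p)
        + ∑ l, dotSlot (if τ.InFront l then -jac id (S.matDir vm) p
            else (jac id (S.matDir vm) p).transpose) l
          (contract (fun l => if τ.InFront l then S.frameMat p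
            else (S.coframeMat p).transpose * S.frameMetric p) (BundleField.frame r p)) J)
      (σ.frameIdx i) := by
    rw [conv, S.bracket_eq hp, convST, sharpST, slotwise_eq_contract, contract_contract]
    congr 1
    · funext l
      rw [τ.pick_eq]
      split_ifs
      · exact Matrix.mul_one _
      · exact S.coframe_mul_inv_eta hp
    · funext J
      rw [lieDeriv_eq, hw, hflat p hp]
      congr 2
      -- The block form of `η` is known on `S.U` only, which suffices since `S.U` is open.
      refine Filter.EventuallyEq.fderiv_eq ?_
      filter_upwards [S.isOpen_U.mem_nhds hp] with q hq
      rw [hflat q hq]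
  rw [hlie, h]
  congr 1
  · simp only [BundleField.frame_frameIdx]
  · refine Finset.sum_congr rfl fun l _ => ?_
    congr 1
    split_ifs
    · simp only [upperCoeff, mul_neg, neg_mul, sub_eq_add_neg]
    · exact lowerCoeff_eq hp vm

/-! ### Entries of the coefficient matrices -/

theorem convVm_eq (hp : p ∈ S.U) {vm : Event → Fin 2 → ℝ}
    (hvm : ∀ i, DifferentiableAt ℝ (fun q => vm q i) p) (i : Fin 2) :
    S.convVm vm p i = fderiv ℝ (fun q => vm q i) p (S.matDir vm p)
      - ∑ j, jac Fin.succ (S.relVel vm) p i j * vm p j := by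
  rw [convVm, instConv_eq hp (fun i => hvm (i 0))]
  simp only [Shuffle.allFront_inFront, if_true, dotSlot_neg]
  simp [dotSlot, sub_eq_add_neg]

theorem jac_matDir (vm : Event → Fin 2 → ℝ) (K : Fin 3) : jac id (S.matDir vm) p 0 K = 0 := by
  rw [jac_apply, show (fun q => S.matDir vm q 0) = fun _ => 1 from rfl]
  simp [pd]

theorem jac_matDir_succ (vm : Event → Fin 2 → ℝ) (i : Fin 2) (K : Fin 3) :
    jac id (S.matDir vm) p i.succ K = pd K (fun q => S.relVel vm q i) p := rfl

theorem pd_relVel (hp : p ∈ S.U) {vm : Event → Fin 2 → ℝ}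
    (hvm : ∀ i, DifferentiableAt ℝ (fun q => vm q i) p) (K : Fin 3) (i : Fin 2) :
    pd K (fun q => S.relVel vm q i) p = pd K (fun q => vm q i) p - pd K (fun q => S.v q i) p := by
  have := ((hvm i).hasFDerivAt.fun_sub (S.differentiableAt_v hp i).hasFDerivAt).fderiv
  exact congrArg (fun L : Event →L[ℝ] ℝ => L (Pi.single K 1)) this

theorem matDeriv_frameMat_zero (w : Event) (K : Fin 3) : matDeriv S.frameMat p w 0 K = 0 := by
  have : (fun q => S.frameMat q 0 K) = fun _ => (1 : Matrix (Fin 3) (Fin 3) ℝ) 0 K := by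
    fin_cases K <;> rfl
  rw [matDeriv_apply, this]
  simp

/-- The coframe matrix differs from the identity in its `t`-column only. -/
theorem coframeMat_mul_apply {A : Matrix (Fin 3) (Fin 3) ℝ} {K : Fin 3} (hA : A 0 K = 0)
    (I : Fin 3) : (S.coframeMat p * A) I K = A I K := by
  rw [Matrix.mul_apply, Fin.sum_univ_three, hA]
  fin_cases I <;> simp [coframeMat, hA]

theorem jac_mul_frameMat_zero (vm : Event → Fin 2 → ℝ) (K : Fin 3) :
    (jac id (S.matDir vm) p * S.frameMat p) 0 K = 0 := by
  simp [Matrix.mul_apply, jac_matDir]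

/-- `τ_𝔪` and the frame vectors have constant `t`-components, so their brackets have none. Hence
upper slots never contribute `r_{σ^β}`. -/
theorem upperCoeff_zero (vm : Event → Fin 2 → ℝ) (K : Fin 3) : S.upperCoeff vm p 0 K = 0 := by
  rw [upperCoeff, Matrix.sub_apply, coframeMat_mul_apply (matDeriv_frameMat_zero _ _),
    Matrix.mul_assoc, coframeMat_mul_apply (jac_mul_frameMat_zero _ _), matDeriv_frameMat_zero,
    jac_mul_frameMat_zero, sub_zero]

theorem upperCoeff_succ (vm : Event → Fin 2 → ℝ) (i : Fin 2) (K : Fin 3) :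
    S.upperCoeff vm p i.succ K = matDeriv S.frameMat p (S.matDir vm p) i.succ K
      - ∑ L, pd L (fun q => S.relVel vm q i) p * S.frameMat p L K := by
  rw [upperCoeff, Matrix.sub_apply, coframeMat_mul_apply (matDeriv_frameMat_zero _ _),
    Matrix.mul_assoc, coframeMat_mul_apply (jac_mul_frameMat_zero _ _), Matrix.mul_apply]
  simp only [jac_matDir_succ]

theorem upperCoeff_succ_succ (vm : Event → Fin 2 → ℝ) (i j : Fin 2) :
    S.upperCoeff vm p i.succ j.succ = -jac Fin.succ (S.relVel vm) p i j := by
  have h : matDeriv S.frameMat p (S.matDir vm p) i.succ j.succ = 0 := by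
    simp [matDeriv_apply, S.frameMat_succ]
  rw [upperCoeff_succ, h]
  simp [S.frameMat_succ, jac_apply]

/-- The bracket of `[1, u]` with `[1, -v]`: the time derivatives add up to `-∂_t v_𝔪`, and `u·∂v -
v·∂u = u·∂v_𝔪 - v_𝔪·∂u`. -/
theorem upperCoeff_succ_zero (hp : p ∈ S.U) {vm : Event → Fin 2 → ℝ}
    (hvm : ∀ i, DifferentiableAt ℝ (fun q => vm q i) p) (i : Fin 2) :
    S.upperCoeff vm p i.succ 0 = -S.convVm vm p i := by
  have h : matDeriv S.frameMat p (S.matDir vm p) i.succ 0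
      = -fderiv ℝ (fun q => S.v q i) p (S.matDir vm p) := by
    have : (fun q => S.frameMat q i.succ 0) = fun q => -S.v q i := by
      fin_cases i <;> rfl
    rw [matDeriv_apply, this, fderiv_fun_neg]
    rfl
  rw [upperCoeff_succ, h, convVm_eq hp hvm]
  simp only [S.fderiv_matDir, dotScalar, Fin.sum_univ_succ (n := 2), S.frameMat_zero, jac_apply,
    pd_relVel hp hvm, Fin.sum_univ_two]
  simp [tau_zero, tau_one, tau_two, relVel]
  ring

theorem frameMetric_succ (q : Event) (i j : Fin 2) :
    S.frameMetric q i.succ j.succ = S.g q i j := by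
  fin_cases i <;> fin_cases j <;> rfl

theorem frameMetric_succ_zero (q : Event) (i : Fin 2) : S.frameMetric q i.succ 0 = 0 := by
  fin_cases i <;> rfl

theorem frameMetric_zero_succ (q : Event) (i : Fin 2) : S.frameMetric q 0 i.succ = 0 := by
  fin_cases i <;> rfl

theorem frameMetricInv_succ (q : Event) (i j : Fin 2) :
    S.frameMetricInv q i.succ j.succ = (S.g q)⁻¹ i j := by
  fin_cases i <;> fin_cases j <;> rfl

theorem frameMetricInv_succ_zero (q : Event) (i : Fin 2) : S.frameMetricInv q i.succ 0 = 0 := by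
  fin_cases i <;> rfl

theorem frameMetricInv_zero_succ (q : Event) (i : Fin 2) : S.frameMetricInv q 0 i.succ = 0 := by
  fin_cases i <;> rfl

theorem frameMetricInv_zero_zero (q : Event) : S.frameMetricInv q 0 0 = S.zeta q := rfl

theorem lowerCoeff_zero_zero (hp : p ∈ S.U) (vm : Event → Fin 2 → ℝ) :
    S.lowerCoeff vm p 0 0 = S.zeta p * (2 * S.nu p * S.dotScalar vm S.nu p) := by
  have h : matDeriv S.frameMetric p (S.matDir vm p) 0 0
      = 2 * S.nu p * S.dotScalar vm S.nu p := by
    have h1 := ((S.differentiableAt_nu hp).hasFDerivAt.pow 2).const_add 1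
    have h2 : (fun q => S.frameMetric q 0 0) = fun q => 1 + S.nu q ^ 2 := rfl
    rw [matDeriv_apply, h2, ← S.fderiv_matDir]
    refine (congrArg (fun L : Event →L[ℝ] ℝ => L (S.matDir vm p)) h1.fderiv).trans ?_
    simp
  simp [lowerCoeff, Matrix.mul_apply, Fin.sum_univ_succ (n := 2), upperCoeff_zero,
    frameMetricInv_zero_zero, frameMetricInv_zero_succ, frameMetric_succ_zero, h]

/-- The metric blocks do not mix, so this is the transposed `τ`-column of `upperCoeff`, lowered by
`g` and raised by `ζ`, with opposite sign. -/
theorem lowerCoeff_zero_succ (hp : p ∈ S.U) {vm : Event → Fin 2 → ℝ}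
    (hvm : ∀ i, DifferentiableAt ℝ (fun q => vm q i) p) (k : Fin 2) :
    S.lowerCoeff vm p 0 k.succ = S.zeta p * S.convVmLow vm p k := by
  have h : matDeriv S.frameMetric p (S.matDir vm p) 0 k.succ = 0 := by
    have : (fun q => S.frameMetric q 0 k.succ) = fun _ => 0 := by fin_cases k <;> rfl
    rw [matDeriv_apply, this]
    simp
  rw [lowerCoeff, Matrix.sub_apply, Matrix.mul_apply, Matrix.mul_apply]
  simp only [Fin.sum_univ_succ (n := 2), Matrix.mul_apply, Matrix.transpose_apply,
    frameMetricInv_zero_zero, frameMetricInv_zero_succ, frameMetric_zero_succ, frameMetric_succ, h,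
    upperCoeff_succ_zero hp hvm, convVmLow, S.g_symm p k, Fin.sum_univ_two]
  ring

theorem lowerCoeff_succ_zero (vm : Event → Fin 2 → ℝ) (i : Fin 2) :
    S.lowerCoeff vm p i.succ 0 = 0 := by
  simp [lowerCoeff, Matrix.mul_apply, Fin.sum_univ_succ (n := 2), upperCoeff_zero,
    frameMetric_succ_zero, frameMetricInv_succ_zero, matDeriv_apply]

theorem lowerCoeff_succ_succ (hp : p ∈ S.U) (vm : Event → Fin 2 → ℝ) (i j : Fin 2) :
    S.lowerCoeff vm p i.succ j.succ
      = (S.connection p (S.matDir vm p) + S.tr p (S.connection p (S.matDir vm p))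
          + S.tr p (jac Fin.succ (S.relVel vm) p)) i j := by
  rw [← S.inv_g_mul_matDeriv_g hp, lowerCoeff, tr]
  simp only [Matrix.sub_apply, Matrix.add_apply, Matrix.mul_apply, Fin.sum_univ_succ (n := 2),
    Matrix.transpose_apply, upperCoeff_zero, upperCoeff_succ_succ, frameMetricInv_succ,
    frameMetricInv_succ_zero, frameMetric_succ, frameMetric_zero_succ, matDeriv_apply, Fin.sum_univ_two]
  ring

end

end MovingSurface

/-! ### Assembling the formulas -/

namespace MovingSurface

variable {S : MovingSurface} {p : Event}

/-- Split the slot sum of `conv_frame` along `σ`. Off-diagonal entries change the shuffle, the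
`(0,0)` entry gives the `νν̇` term, and the spatial block reproduces `instConv_eq`. -/
theorem conv_eq (hp : p ∈ S.U) {n a b α m : ℕ} {r : BundleField n}
    (hr : ∀ (α m : ℕ) (σ : Shuffle n α m) (i : Fin m → Fin 2),
      DifferentiableAt ℝ (fun q => r σ q i) p) {vm : Event → Fin 2 → ℝ}
    (hvm : ∀ i, DifferentiableAt ℝ (fun q => vm q i) p)
    (τ : Shuffle n a b) (σ : Shuffle n α m) (i : Fin m → Fin 2) :
    S.conv vm τ r σ p i
      = S.instConv vm (τ.remove σ) (r σ) p i
        + S.zeta p * (∑ β : Fin α, if ¬ τ.InFront (σ.front β) then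
            (∑ k, S.convVmLow vm p k * r (σ.toRear β) p (insertIdx (σ.bar β) k i))
              + 2 * S.nu p * S.dotScalar vm S.nu p * r σ p i else 0)
        - ∑ β : Fin m, if τ.InFront (σ.rear β) then
            S.convVm vm p (i β) * r (σ.toFront β) p (omitIdx β i) else 0 := by
  have h1 : ∀ β : Fin α, dotSlot (if τ.InFront (σ.front β) then S.upperCoeff vm p
      else S.lowerCoeff vm p) (σ.front β) (BundleField.frame r p) (σ.frameIdx i)
      = S.zeta p * if ¬ τ.InFront (σ.front β) then
            (∑ k, S.convVmLow vm p k * r (σ.toRear β) p (insertIdx (σ.bar β) k i))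
              + 2 * S.nu p * S.dotScalar vm S.nu p * r σ p i else 0 := by
    intro β
    have h0 : Function.update (σ.frameIdx i) (σ.front β) 0 = σ.frameIdx i := by
      rw [← σ.frameIdx_front i β, Function.update_eq_self]
    rw [dotSlot, Fin.sum_univ_succ, h0, σ.frameIdx_front, BundleField.frame_frameIdx]
    simp only [BundleField.frame_update_front]
    split_ifs with h
    · simp [upperCoeff_zero]
    · simp only [lowerCoeff_zero_zero hp, lowerCoeff_zero_succ hp hvm, Fin.sum_univ_two]
      ring
  have h2 : ∀ β : Fin m, dotSlot (if τ.InFront (σ.rear β) then S.upperCoeff vm p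
      else S.lowerCoeff vm p) (σ.rear β) (BundleField.frame r p) (σ.frameIdx i)
      = dotSlot (if τ.InFront (σ.rear β) then -jac Fin.succ (S.relVel vm) p
          else S.connection p (S.matDir vm p) + S.tr p (S.connection p (S.matDir vm p))
            + S.tr p (jac Fin.succ (S.relVel vm) p)) β (r σ p) i
        - if τ.InFront (σ.rear β) then
            S.convVm vm p (i β) * r (σ.toFront β) p (omitIdx β i) else 0 := by
    intro β
    rw [dotSlot, Fin.sum_univ_succ, σ.frameIdx_rear, BundleField.frame_update_rear_zero]
    simp only [BundleField.frame_update_rear]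
    split_ifs with h
    · simp only [upperCoeff_succ_zero hp hvm, upperCoeff_succ_succ, dotSlot, Matrix.neg_apply]
      ring
    · simp only [lowerCoeff_succ_zero, lowerCoeff_succ_succ hp, dotSlot]
      ring
  rw [conv_frame hp hr, σ.sum_eq, instConv_eq hp (hr _ _ σ)]
  simp only [h1, h2, τ.remove_inFront, Finset.sum_sub_distrib, Finset.mul_sum]
  ring

section Surface

variable {m a b : ℕ} {r : SurfaceField m}

theorem instConv_eq_dtShuffled (hp : p ∈ S.U) (hr : ∀ i, DifferentiableAt ℝ (fun q => r q i) p)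
    (vm : Event → Fin 2 → ℝ) (τ : Shuffle m a b) (i : Fin m → Fin 2) :
    S.instConv vm τ r p i
      = S.dtShuffled τ r p i + S.nablaDir (S.relVel vm) r p i
        - (∑ β : Fin m, if τ.InFront β then
            dotSlot (S.grad (S.relVel vm) p) β (r p) i else 0)
        + ∑ β : Fin m, if ¬ τ.InFront β then
            dotSlot (S.tr p (S.grad (S.relVel vm) p)) β (r p) i else 0 := by
  have h := S.nablaDir_relVel hp vm r i
  have h2 : S.dtShuffled τ r p i + S.nablaDir (S.relVel vm) r p i
      = (pd 0 (fun q => r q i) p + S.nablaDir (S.relVel vm) r p i)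
      + ∑ β, dotSlot (if τ.InFront β then 0 else S.B p + S.tr p (S.B p)) β (r p) i := by
    rw [dtShuffled_eq hp hr]; ring
  rw [h2, h, instConv_eq hp hr, add_assoc, add_sub_assoc, add_assoc, add_assoc]
  congr 1
  simp only [← Finset.sum_add_distrib, ← Finset.sum_sub_distrib]
  refine Finset.sum_congr rfl fun β _ => ?_
  -- The non-tensorial `jac` of `u` now cancels slot by slot, leaving `∇u`, `𝓑` and their
  -- transposes.
  rw [S.connection_matDir hp]
  split_ifs
  · simp only [dotSlot_sub, dotSlot_neg, dotSlot_zero]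
    ring
  · simp only [S.tr_add, S.tr_sub, dotSlot_add, dotSlot_sub]
    ring

theorem instConv_eq_dot (hp : p ∈ S.U) (hr : ∀ i, DifferentiableAt ℝ (fun q => r q i) p)
    {vm : Event → Fin 2 → ℝ} (hvm : ∀ i, DifferentiableAt ℝ (fun q => vm q i) p)
    (τ : Shuffle m a b) (i : Fin m → Fin 2) :
    S.instConv vm τ r p i
      = S.dot vm r p i
        - (∑ β : Fin m, if τ.InFront β then dotSlot (S.Bm vm p) β (r p) i else 0)
        + ∑ β : Fin m, if ¬ τ.InFront β then
            dotSlot (S.tr p (S.Bm vm p)) β (r p) i else 0 := by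
  rw [instConv_eq hp hr, dot_eq hp hr, add_sub_assoc,
    add_assoc (fderiv ℝ (fun q => r q i) p (S.matDir vm p))]
  congr 1
  simp only [← Finset.sum_add_distrib, ← Finset.sum_sub_distrib]
  refine Finset.sum_congr rfl fun β _ => ?_
  rw [S.connection_matDir hp, S.Bm_eq hp hvm]
  split_ifs
  · simp only [dotSlot_add, dotSlot_sub, dotSlot_neg]
    ring
  · simp only [S.tr_add, S.tr_sub, dotSlot_add, dotSlot_sub]
    ring

theorem dtShuffled_eq_pd (hp : p ∈ S.U) (hr : ∀ i, DifferentiableAt ℝ (fun q => r q i) p)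
    (τ : Shuffle m a b) (i : Fin m → Fin 2) :
    S.dtShuffled τ r p i = pd 0 (fun q => r q i) p
      + ∑ β : Fin m, if ¬ τ.InFront β then
          dotSlot (S.B p + S.tr p (S.B p)) β (r p) i else 0 := by
  rw [dtShuffled_eq hp hr]
  congr 1
  refine Finset.sum_congr rfl fun β _ => ?_
  split_ifs
  · exact dotSlot_zero _ _ _
  · rfl

theorem dot_eq_pd (hp : p ∈ S.U) (hr : ∀ i, DifferentiableAt ℝ (fun q => r q i) p)
    (vm : Event → Fin 2 → ℝ) (i : Fin m → Fin 2) :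
    S.dot vm r p i = pd 0 (fun q => r q i) p + S.nablaDir (S.relVel vm) r p i
      + ∑ β : Fin m, dotSlot (S.B p) β (r p) i := by
  rw [S.nablaDir_relVel hp, dot_eq hp hr, S.connection_matDir hp]
  simp only [dotSlot_add, Finset.sum_add_distrib]
  ring

theorem dtShuffled_allRear (r : SurfaceField m) (i : Fin m → Fin 2) :
    S.dtShuffled (Shuffle.allRear m) r p i
      = ∑ j : Fin m → Fin 2, (∏ β, (S.g p)⁻¹ (i β) (j β))
          * pd 0 (fun q => ∑ l : Fin m → Fin 2, (∏ β, S.g q (j β) (l β)) * r q l) p := rfl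

theorem convVm_eq_grad (hp : p ∈ S.U) {vm : Event → Fin 2 → ℝ}
    (hvm : ∀ i, DifferentiableAt ℝ (fun q => vm q i) p) (i : Fin 2) :
    S.convVm vm p i = pd 0 (fun q => vm q i) p
      + S.grad vm p i ⬝ᵥ S.relVel vm p - S.grad (S.relVel vm) p i ⬝ᵥ vm p := by
  rw [convVm_eq hp hvm, S.fderiv_matDir]
  -- The Christoffel terms of `∇_u v_𝔪` and `∇_{v_𝔪} u` cancel by symmetry.
  simp only [dotScalar, dotProduct, grad, jac_apply, Fin.sum_univ_two, S.Gam_symm hp i 0 1]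
  ring

theorem rot_hodge (hp : p ∈ S.U) (vm : Event → Fin 2 → ℝ) (r : (Fin m → Fin 2) → ℝ)
    (i : Fin m → Fin 2) :
    S.rot vm p / 2 * ∑ β : Fin m, S.hodge p β r i
      = 1 / 2 * (∑ β, dotSlot (S.Bm vm p) β r i - ∑ β, dotSlot (S.tr p (S.Bm vm p)) β r i) := by
  rw [← Finset.sum_sub_distrib, Finset.mul_sum, Finset.mul_sum]
  refine Finset.sum_congr rfl fun β _ => ?_
  rw [← dotSlot_sub, S.Bm_sub_tr hp, dotSlot_smul, hodge]
  ring

end Surface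

theorem jaumann_eq (hp : p ∈ S.U) (vm : Event → Fin 2 → ℝ) {n α m : ℕ} (r : BundleField n)
    (σ : Shuffle n α m) (i : Fin m → Fin 2) :
    S.jaumann vm r σ p i = 1 / 2 * (S.conv vm (Shuffle.allFront n) r σ p i
      + S.conv vm (Shuffle.allRear n) r σ p i) := by
  simp only [jaumann, conv, S.bracket_eq hp, contract, jaumannST, ← Finset.sum_add_distrib,
    Finset.mul_sum]
  refine Finset.sum_congr rfl fun J _ => ?_
  ring

/-- Only the set of lowered slots matters. This replaces `τ.remove σ`, whose type carries
cardinalities, by `allFront m` or `allRear m`. -/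
theorem instConv_congr (hp : p ∈ S.U) {m a b a' b' : ℕ} {r : SurfaceField m}
    (hr : ∀ i, DifferentiableAt ℝ (fun q => r q i) p) (vm : Event → Fin 2 → ℝ)
    {τ : Shuffle m a b} {τ' : Shuffle m a' b'} (h : ∀ β, τ.InFront β ↔ τ'.InFront β)
    (i : Fin m → Fin 2) : S.instConv vm τ r p i = S.instConv vm τ' r p i := by
  rw [instConv_eq hp hr, instConv_eq hp hr]
  simp only [h]

theorem conv_allFront (hp : p ∈ S.U) {n α m : ℕ} {r : BundleField n}
    (hr : ∀ (α m : ℕ) (σ : Shuffle n α m) (i : Fin m → Fin 2),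
      DifferentiableAt ℝ (fun q => r σ q i) p) {vm : Event → Fin 2 → ℝ}
    (hvm : ∀ i, DifferentiableAt ℝ (fun q => vm q i) p)
    (σ : Shuffle n α m) (i : Fin m → Fin 2) :
    S.conv vm (Shuffle.allFront n) r σ p i
      = S.instConv vm (Shuffle.allFront m) (r σ) p i
        - ∑ β : Fin m, S.convVm vm p (i β) * r (σ.toFront β) p (omitIdx β i) := by
  rw [conv_eq hp hr hvm, instConv_congr hp (hr _ _ σ) vm (τ' := Shuffle.allFront m)
    (fun β => by simp only [Shuffle.remove_inFront, Shuffle.allFront_inFront])]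
  simp only [Shuffle.allFront_inFront, not_true_eq_false, if_true, if_false,
    Finset.sum_const_zero, mul_zero, add_zero]

theorem conv_allRear (hp : p ∈ S.U) {n α m : ℕ} {r : BundleField n}
    (hr : ∀ (α m : ℕ) (σ : Shuffle n α m) (i : Fin m → Fin 2),
      DifferentiableAt ℝ (fun q => r σ q i) p) {vm : Event → Fin 2 → ℝ}
    (hvm : ∀ i, DifferentiableAt ℝ (fun q => vm q i) p)
    (σ : Shuffle n α m) (i : Fin m → Fin 2) :
    S.conv vm (Shuffle.allRear n) r σ p i
      = S.instConv vm (Shuffle.allRear m) (r σ) p i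
        + 2 * α * S.zeta p * S.nu p * S.dotScalar vm S.nu p * r σ p i
        + S.zeta p * ∑ k, S.convVmLow vm p k
            * ∑ β : Fin α, r (σ.toRear β) p (insertIdx (σ.bar β) k i) := by
  rw [conv_eq hp hr hvm, instConv_congr hp (hr _ _ σ) vm (τ' := Shuffle.allRear m)
    (fun β => by simp only [Shuffle.remove_inFront, Shuffle.allRear_not_inFront])]
  simp only [Shuffle.allRear_not_inFront, not_false_eq_true, if_true, if_false,
    Finset.sum_const_zero, sub_zero, Finset.sum_add_distrib, Finset.sum_const, Finset.card_univ,
    Fintype.card_fin, nsmul_eq_mul]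
  rw [Finset.sum_comm]
  simp only [← Finset.mul_sum]
  ring

end MovingSurface

end

/-! ### The theorem -/

theorem theorem2 (S : MovingSurface) (vm : Event → Fin 2 → ℝ)
    (hvm : ∀ i, ContDiffOn ℝ ∞ (fun q => vm q i) S.U)
    (n : ℕ) (r : BundleField n)
    (hr : ∀ (α m : ℕ) (σ : Shuffle n α m) (i : Fin m → Fin 2),
      ContDiffOn ℝ ∞ (fun q => r σ q i) S.U)
    (p : Event) (hp : p ∈ S.U) :
    -- the instantaneous upper convected derivative of the tangential material velocity
    (∀ i, S.convVm vm p i = pd 0 (fun q => vm q i) p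
      + S.grad vm p i ⬝ᵥ S.relVel vm p - S.grad (S.relVel vm) p i ⬝ᵥ vm p) ∧
    -- all shuffled convected derivatives
    (∀ (a b : ℕ) (τ : Shuffle n a b) (α m : ℕ) (σ : Shuffle n α m),
      (∀ i : Fin m → Fin 2,
        S.conv vm τ r σ p i
          = S.instConv vm (τ.remove σ) (r σ) p i
            + S.zeta p * (∑ β : Fin α, if ¬ τ.InFront (σ.front β) then
                (∑ k, S.convVmLow vm p k * r (σ.toRear β) p (insertIdx (σ.bar β) k i))
                  + 2 * S.nu p * S.dotScalar vm S.nu p * r σ p i else 0)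
            - ∑ β : Fin m, if τ.InFront (σ.rear β) then
                S.convVm vm p (i β) * r (σ.toFront β) p (omitIdx β i) else 0) ∧
      (∀ i : Fin m → Fin 2,
        S.instConv vm (τ.remove σ) (r σ) p i
          = S.dtShuffled (τ.remove σ) (r σ) p i + S.nablaDir (S.relVel vm) (r σ) p i
            - (∑ β : Fin m, if τ.InFront (σ.rear β) then
                dotSlot (S.grad (S.relVel vm) p) β (r σ p) i else 0)
            + ∑ β : Fin m, if ¬ τ.InFront (σ.rear β) then
                dotSlot (S.tr p (S.grad (S.relVel vm) p)) β (r σ p) i else 0) ∧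
      (∀ i : Fin m → Fin 2,
        S.instConv vm (τ.remove σ) (r σ) p i
          = S.dot vm (r σ) p i
            - (∑ β : Fin m, if τ.InFront (σ.rear β) then
                dotSlot (S.Bm vm p) β (r σ p) i else 0)
            + ∑ β : Fin m, if ¬ τ.InFront (σ.rear β) then
                dotSlot (S.tr p (S.Bm vm p)) β (r σ p) i else 0) ∧
      (∀ i : Fin m → Fin 2,
        S.dtShuffled (τ.remove σ) (r σ) p i
          = pd 0 (fun q => r σ q i) p
            + ∑ β : Fin m, if ¬ τ.InFront (σ.rear β) then
                dotSlot (S.B p + S.tr p (S.B p)) β (r σ p) i else 0) ∧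
      (∀ β : Fin m, τ.InFront (σ.rear β) ↔ (τ.remove σ).InFront β)) ∧
    -- the upper, the lower and the Jaumann derivative
    (∀ (α m : ℕ) (σ : Shuffle n α m) (i : Fin m → Fin 2),
      S.conv vm (Shuffle.allFront n) r σ p i
          = S.instConv vm (Shuffle.allFront m) (r σ) p i
            - ∑ β : Fin m, S.convVm vm p (i β) * r (σ.toFront β) p (omitIdx β i) ∧
      S.conv vm (Shuffle.allRear n) r σ p i
          = S.instConv vm (Shuffle.allRear m) (r σ) p i
            + 2 * α * S.zeta p * S.nu p * S.dotScalar vm S.nu p * r σ p i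
            + S.zeta p * ∑ k, S.convVmLow vm p k
                * ∑ β : Fin α, r (σ.toRear β) p (insertIdx (σ.bar β) k i) ∧
      S.instConv vm (Shuffle.allFront m) (r σ) p i
          = pd 0 (fun q => r σ q i) p + S.nablaDir (S.relVel vm) (r σ) p i
            - ∑ β : Fin m, dotSlot (S.grad (S.relVel vm) p) β (r σ p) i ∧
      S.instConv vm (Shuffle.allFront m) (r σ) p i
          = S.dot vm (r σ) p i - ∑ β : Fin m, dotSlot (S.Bm vm p) β (r σ p) i ∧
      S.instConv vm (Shuffle.allRear m) (r σ) p i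
          = (∑ j : Fin m → Fin 2, (∏ β, (S.g p)⁻¹ (i β) (j β))
                * pd 0 (fun q => ∑ l : Fin m → Fin 2, (∏ β, S.g q (j β) (l β)) * r σ q l) p)
            + S.nablaDir (S.relVel vm) (r σ) p i
            + ∑ β : Fin m, dotSlot (S.tr p (S.grad (S.relVel vm) p)) β (r σ p) i ∧
      S.instConv vm (Shuffle.allRear m) (r σ) p i
          = S.dot vm (r σ) p i + ∑ β : Fin m, dotSlot (S.tr p (S.Bm vm p)) β (r σ p) i ∧
      S.dot vm (r σ) p i
          = pd 0 (fun q => r σ q i) p + S.nablaDir (S.relVel vm) (r σ) p i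
            + ∑ β : Fin m, dotSlot (S.B p) β (r σ p) i ∧
      S.jaumann vm r σ p i
          = 1 / 2 * (S.conv vm (Shuffle.allFront n) r σ p i
              + S.conv vm (Shuffle.allRear n) r σ p i) ∧
      S.jaumann vm r σ p i
          = S.dot vm (r σ) p i
            + α * S.zeta p * S.nu p * S.dotScalar vm S.nu p * r σ p i
            - S.rot vm p / 2 * ∑ β : Fin m, S.hodge p β (r σ p) i
            + S.zeta p / 2 * ∑ k, S.convVmLow vm p k
                * ∑ β : Fin α, r (σ.toRear β) p (insertIdx (σ.bar β) k i)
            - 1 / 2 * ∑ β : Fin m,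
                S.convVm vm p (i β) * r (σ.toFront β) p (omitIdx β i)) := by
  have dvm : ∀ i, DifferentiableAt ℝ (fun q => vm q i) p := fun i =>
    (hvm i).differentiableAt_of_isOpen S.isOpen_U hp
  have dr : ∀ (α m : ℕ) (σ : Shuffle n α m) (i : Fin m → Fin 2),
      DifferentiableAt ℝ (fun q => r σ q i) p := fun α m σ i =>
    (hr α m σ i).differentiableAt_of_isOpen S.isOpen_U hp
  refine ⟨MovingSurface.convVm_eq_grad hp dvm, fun a b τ α m σ => ⟨?_, ?_, ?_, ?_, ?_⟩,
    fun α m σ i => ?_⟩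
  · exact MovingSurface.conv_eq hp dr dvm τ σ
  · intro i
    simpa only [Shuffle.remove_inFront]
      using MovingSurface.instConv_eq_dtShuffled hp (dr _ _ σ) vm (τ.remove σ) i
  · intro i
    simpa only [Shuffle.remove_inFront]
      using MovingSurface.instConv_eq_dot hp (dr _ _ σ) dvm (τ.remove σ) i
  · intro i
    simpa only [Shuffle.remove_inFront]
      using MovingSurface.dtShuffled_eq_pd hp (dr _ _ σ) (τ.remove σ) i
  · exact fun β => (τ.remove_inFront σ β).symm
  · have hF := MovingSurface.conv_allFront hp dr dvm σ i
    have hR := MovingSurface.conv_allRear hp dr dvm σ i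
    have hJ := MovingSurface.jaumann_eq hp vm r σ i
    have hF1 := MovingSurface.instConv_eq_dtShuffled hp (dr _ _ σ) vm (Shuffle.allFront m) i
    have hR1 := MovingSurface.instConv_eq_dtShuffled hp (dr _ _ σ) vm (Shuffle.allRear m) i
    have hF2 := MovingSurface.instConv_eq_dot hp (dr _ _ σ) dvm (Shuffle.allFront m) i
    have hR2 := MovingSurface.instConv_eq_dot hp (dr _ _ σ) dvm (Shuffle.allRear m) i
    rw [MovingSurface.dtShuffled_eq_pd hp (dr _ _ σ)] at hF1
    rw [MovingSurface.dtShuffled_allRear] at hR1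
    simp only [Shuffle.allFront_inFront, Shuffle.allRear_not_inFront, not_true_eq_false,
      not_false_eq_true, if_true, if_false, Finset.sum_const_zero, add_zero, sub_zero]
      at hF1 hR1 hF2 hR2
    refine ⟨hF, hR, hF1, hF2, hR1, hR2, MovingSurface.dot_eq_pd hp (dr _ _ σ) vm i, hJ, ?_⟩
    -- With both derivatives in total-derivative form, their mean contains `𝓑_𝔪` only through minus
    -- half of `𝓑_𝔪 - 𝓑_𝔪ᵀ`, which is the curl term.
    rw [hJ, hF, hR, hF2, hR2, MovingSurface.rot_hodge hp]
    ring
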